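/- **Setting.** Let $K$ be a commutative $\mathbb{Q}$-algebra. Functions of the multi-time $t=(t_1,t_2,\dots)$, $x=t_1$, are formal power series in $t_1,t_2,\dots$ over $K$; put $\partial=\partial/\partial x$. Pseudo-differential operators are formal sums $\sum_{j\le N}a_j(t)D^j$ with the product determined by $D^n f=\sum_{k\ge0}\binom nk(\partial^kf)D^{n-k}$ ($n\in\mathbb{Z}$); $A_+=\sum_{j\ge0}a_jD^j$, and $A^*=\sum_j(-D)^ja_j$. Let $r\ge1$ and let $$L=D^r+\sum_{j=0}^{r-2}v_jD^j+\sum_{i\ge1}u_iD^{-i}$$ be a Lax operator of the general KP hierarchy, that is, $\partial L/\partial t_n=[L^{n/r}_+,L]$ for all $n\ge1$, where $L^{1/r}=D+\cdots$ is the monic $r$-th root of $L$. Let $W=1+\sum_{i\ge1}w_iD^{-i}$ be a dressing operator of $L$: $L=WD^rW^{-1}$ and $\partial W/\partial t_n=L^{n/r}_+W-WD^n$ for all $n\ge1$. With $\xi(t,\lambda)=\sum_{n\ge1}t_n\lambda^n$, the Baker–Akhiezer (BA) function and the adjoint BA function are $$\psi_{BA}(t,\lambda)=W\bigl(e^{\xi(t,\lambda)}\bigr),\qquad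 \psi^*_{BA}(t,\lambda)=(W^*)^{-1}\bigl(e^{-\xi(t,\lambda)}\bigr),$$ regarded as two-sided formal series in $\lambda$. Write $[\lambda^{-1}]=(\lambda^{-1},\tfrac12\lambda^{-2},\tfrac13\lambda^{-3},\dots)$, and let $\int d\lambda$ be the formal residue at $\lambda=0$ (the coefficient of $\lambda^{-1}$). A function $\Phi$ is an eigenfunction if $\partial\Phi/\partial t_n=L^{n/r}_+(\Phi)$ for all $n\ge1$; a function $\Psi$ is an adjoint eigenfunction if $\partial\Psi/\partial t_n=-(L^*)^{n/r}_+(\Psi)$ for all $n\ge1$, where $(L^*)^{1/r}=(L^{1/r})^*$. **Proposition.** Every eigenfunction $\Phi$ and every adjoint eigenfunction $\Psi$ has a spectral representation $$\Phi(t)=\int d\lambda\,\varphi(\lambda)\,\psi_{BA}(t,\lambda),\qquad \Psi(t)=\int d\lambda\,\varphi^*(\lambda)\,\psi^*_{BA}(t,\lambda),$$ with spectral densities $$\varphi(\lambda)=\frac1\lambda\,\psi^*_{BA}(t',\lambda)\,\Phi(t'+[\lambda^{-1}]),\qquad \varphi^*(\lambda)=\frac1\lambda\,\psi_{BA}(t',\lambda)\,\Psi(t'-[\lambda^{-1}]).$$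 Here $t'=(t_1',t_2',\dots)$ is an arbitrary multi-time: all the products of series in $\lambda$ that occur are well defined (each coefficient is a sum of power series with only finitely many non-zero contributions to each monomial), and the two representations hold as identities of formal power series in the independent variables $t$ and $t'$, and also with $t'=0$, where $\varphi(\lambda)$ and $\varphi^*(\lambda)$ have coefficients in $K$. Moreover the two right-hand sides do not depend on $t'$: their derivatives with respect to every $t'_n$ vanish. -/

import Mathlib

/-! Functions of the multi-time are formal power series in `t 1, t 2, …` (indexed by `ℕ+`) over a
commutative `ℚ`-algebra `K`; the space variable is `x = t 1`. -/

noncomputable section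

namespace KP

/-- Formal functions of the KP multi-time `t = (t 1, t 2, …)`. -/
abbrev Fn (K : Type*) : Type _ := MvPowerSeries ℕ+ K

/-- The derivative `∂ / ∂ t n`. -/
abbrev dt {K : Type*} [CommRing K] (n : ℕ+) (f : Fn K) : Fn K :=
  MvPowerSeries.pderiv K n f

/-- The derivative `∂ = ∂ / ∂ x`, where `x = t 1`. -/
abbrev dx {K : Type*} [CommRing K] (f : Fn K) : Fn K := dt 1 f

/-- Formal pseudo-differential operators `∑ j ≤ N, a j * D ^ j`; `coeff j` is the coefficient `a j`,
written to the left of `D ^ j`. -/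
@[ext]
structure PDO (K : Type*) [CommRing K] where
  coeff : ℤ → Fn K
  bdd : ∃ N : ℤ, ∀ n : ℤ, N < n → coeff n = 0

namespace PDO

variable {K : Type*} [CommRing K]

/-- Only finitely many terms contribute to a coefficient of a product. -/
theorem mul_support_finite (A B : PDO K) (n : ℤ) :
    (Function.support fun p : ℤ × ℕ => (Ring.choose p.1 p.2 : ℤ) •
      (A.coeff p.1 * (dx^[p.2]) (B.coeff (n - p.1 + p.2)))).Finite := by
  obtain ⟨N, hN⟩ := A.bdd
  obtain ⟨M, hM⟩ := B.bdd
  refine ((Set.finite_Icc (n - M) N).prod (Set.finite_Iic (M - n + N).toNat)).subset ?_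
  rintro ⟨i, k⟩ h
  have hd : ∀ k : ℕ, (dx^[k]) (0 : Fn K) = 0 := fun k =>
    Function.iterate_fixed (map_zero (MvPowerSeries.pderiv K (1 : ℕ+))) k
  have h1 : i ≤ N := by
    by_contra hlt
    exact h (by simp [hN i (by omega)])
  have h2 : n - i + k ≤ M := by
    by_contra hlt
    exact h (by simp only [hM (n - i + k) (by omega), hd, mul_zero, smul_zero])
  simp only [Set.mem_prod, Set.mem_Icc, Set.mem_Iic]
  omega

instance : Zero (PDO K) := ⟨⟨fun _ => 0, 0, fun _ _ => rfl⟩⟩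

/-- The operator `D ^ n`, for any integer `n`. -/
def D (n : ℤ) : PDO K where
  coeff k := if k = n then 1 else 0
  bdd := ⟨n, fun k hk => if_neg (by omega)⟩

instance : One (PDO K) := ⟨D 0⟩

instance : Sub (PDO K) where
  sub A B :=
    { coeff := fun n => A.coeff n - B.coeff n
      bdd := by
        obtain ⟨N, hN⟩ := A.bdd
        obtain ⟨M, hM⟩ := B.bdd
        exact ⟨max N M, fun n hn => by
          rw [hN n (lt_of_le_of_lt (le_max_left _ _) hn),
            hM n (lt_of_le_of_lt (le_max_right _ _) hn), sub_zero]⟩ }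

/-- The product given by the generalized Leibniz rule
`D ^ i * b = ∑ k, (i choose k) * (∂ ^ k b) * D ^ (i - k)`. -/
instance : Mul (PDO K) where
  mul A B :=
    { coeff := fun n => ∑ᶠ p : ℤ × ℕ, (Ring.choose p.1 p.2 : ℤ) •
        (A.coeff p.1 * (dx^[p.2]) (B.coeff (n - p.1 + p.2)))
      bdd := by
        obtain ⟨N, hN⟩ := A.bdd
        obtain ⟨M, hM⟩ := B.bdd
        refine ⟨N + M, fun n hn => ?_⟩
        rw [← finsum_zero (α := ℤ × ℕ)]
        refine finsum_congr fun p => ?_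
        by_cases h : N < p.1
        · simp [hN p.1 h]
        · rw [hM (n - p.1 + p.2) (by omega),
            Function.iterate_fixed (map_zero (MvPowerSeries.pderiv K (1 : ℕ+))), mul_zero,
            smul_zero] }

instance : Pow (PDO K) ℕ where
  pow A n := Nat.rec 1 (fun _ B => B * A) n

/-- The purely differential part `A₊`. -/
def plus (A : PDO K) : PDO K where
  coeff n := if 0 ≤ n then A.coeff n else 0
  bdd := by
    obtain ⟨N, hN⟩ := A.bdd
    exact ⟨N, fun n hn => by simp [hN n hn]⟩

/-- The coefficientwise derivative `∂ A / ∂ t n`. -/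
def flow (n : ℕ+) (A : PDO K) : PDO K where
  coeff k := dt n (A.coeff k)
  bdd := by
    obtain ⟨N, hN⟩ := A.bdd
    exact ⟨N, fun k hk => by rw [hN k hk]; exact map_zero (MvPowerSeries.pderiv K n)⟩

/-- The formal adjoint `A* = ∑ j, (-D) ^ j * a j` of `A = ∑ j, a j * D ^ j`. -/
def adj (A : PDO K) : PDO K where
  coeff n := ∑ᶠ k : ℕ, (((n + k).negOnePow : ℤ) * Ring.choose (n + k) k) •
    (dx^[k]) (A.coeff (n + k))
  bdd := by
    obtain ⟨N, hN⟩ := A.bdd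
    refine ⟨N, fun n hn => ?_⟩
    rw [← finsum_zero (α := ℕ)]
    refine finsum_congr fun k => ?_
    rw [hN (n + k) (by omega),
      Function.iterate_fixed (map_zero (MvPowerSeries.pderiv K (1 : ℕ+))), smul_zero]

/-- The inverse `∑ k, (1 - A) ^ k` of an operator of the form `A = 1 + ∑ i ≥ 1, a i * D ^ (-i)`.
As `(1 - A) ^ k` has order at most `-k`, only the terms `k ≤ -n` reach the coefficient of `D ^ n`. -/
def inv (A : PDO K) : PDO K where
  coeff n := ∑ k ∈ Finset.range ((-n).toNat + 1), ((1 - A) ^ k).coeff n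
  bdd := by
    refine ⟨0, fun n hn => ?_⟩
    have h0 : (-n).toNat = 0 := by omega
    rw [h0, zero_add, Finset.sum_range_one]
    exact if_neg hn.ne'

/-- The action `A₊ (f) = ∑ j ≥ 0, a j * ∂ ^ j f` of the purely differential part on a function. -/
def plusApply (A : PDO K) (f : Fn K) : Fn K := ∑ᶠ j : ℕ, A.coeff j * (dx^[j]) f

end PDO

section Hierarchy

variable {K : Type*} [CommRing K]

/-- `L = D ^ r + ∑ 0 ≤ j ≤ r - 2, v j * D ^ j + ∑ i ≥ 1, u i * D ^ (-i)`. -/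
structure IsLaxForm (r : ℕ) (L : PDO K) : Prop where
  lead : L.coeff r = 1
  sub_lead : L.coeff (r - 1) = 0
  above : ∀ n : ℤ, (r : ℤ) < n → L.coeff n = 0

/-- `Q = L ^ (1 / r)`: the `r`-th root of `L` of the form `D + (lower order terms)`. Consequently
`Q ^ n` is `L ^ (n / r)`. -/
structure IsRoot (r : ℕ) (L Q : PDO K) : Prop where
  lead : Q.coeff 1 = 1
  above : ∀ n : ℤ, 1 < n → Q.coeff n = 0
  pow_eq : Q ^ r = L

/-- `L` is a Lax operator of the general KP hierarchy, with `Q = L ^ (1 / r)`: it has the required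
form and obeys the Lax equations `∂ L / ∂ t n = [(L ^ (n / r))₊, L]` for all `n ≥ 1`. -/
structure IsKPLax (r : ℕ) (L Q : PDO K) : Prop where
  form : IsLaxForm r L
  root : IsRoot r L Q
  lax : ∀ n : ℕ+, L.flow n = (Q ^ (n : ℕ)).plus * L - L * (Q ^ (n : ℕ)).plus

/-- `W = 1 + ∑ i ≥ 1, w i * D ^ (-i)` is a dressing operator of `L`: `L = W D ^ r W⁻¹`, and `W`
obeys the Wilson-Sato equations `∂ W / ∂ t n = (L ^ (n / r))₊ W - W D ^ n` for all `n ≥ 1`. -/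
structure IsDressing (r : ℕ) (L Q W : PDO K) : Prop where
  lead : W.coeff 0 = 1
  above : ∀ n : ℤ, 0 < n → W.coeff n = 0
  dress : L = W * PDO.D r * W.inv
  sato : ∀ n : ℕ+, W.flow n = (Q ^ (n : ℕ)).plus * W - W * PDO.D n

/-- `Φ` is an eigenfunction: `∂ Φ / ∂ t n = (L ^ (n / r))₊ (Φ)` for all `n ≥ 1`. -/
def IsEigenfunction (Q : PDO K) (Φ : Fn K) : Prop :=
  ∀ n : ℕ+, dt n Φ = (Q ^ (n : ℕ)).plusApply Φ

/-- `Ψ` is an adjoint eigenfunction: `∂ Ψ / ∂ t n = - ((L*) ^ (n / r))₊ (Ψ)` for all `n ≥ 1`, where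
`(L*) ^ (1 / r)` is the adjoint of `Q = L ^ (1 / r)`. -/
def IsAdjEigenfunction (Q : PDO K) (Ψ : Fn K) : Prop :=
  ∀ n : ℕ+, dt n Ψ = - (Q.adj ^ (n : ℕ)).plusApply Ψ

end Hierarchy

section Laurent

/-! A two-sided formal series `∑ k, F k * λ ^ k` in the spectral parameter `λ`, whose coefficients
are power series, is the family `F : ℤ → MvPowerSeries σ K` of its coefficients. -/

variable {σ K : Type*} [CommRing K]

/-- The product of `F` and `G` is defined: for all `k`, the sum of power series
`∑ i, F i * G (k - i)` is, in each monomial, a sum with finitely many non-zero terms. -/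
def MulDefined (F G : ℤ → MvPowerSeries σ K) : Prop :=
  ∀ (k : ℤ) (m : σ →₀ ℕ),
    (Function.support fun i : ℤ => MvPowerSeries.coeff m (F i * G (k - i))).Finite

/-- The product of two series in `λ`: the coefficient of `λ ^ k` is `∑ i, F i * G (k - i)`, summed
monomial by monomial (meaningful if `MulDefined F G`). -/
def lmul (F G : ℤ → MvPowerSeries σ K) : ℤ → MvPowerSeries σ K :=
  fun k m => ∑ᶠ i : ℤ, MvPowerSeries.coeff m (F i * G (k - i))

/-- Multiplication by `λ⁻¹`. -/
def divLambda (F : ℤ → MvPowerSeries σ K) : ℤ → MvPowerSeries σ K := fun k => F (k + 1)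

/-- The integral `∫ dλ`, that is, the residue at `λ = 0`: the coefficient of `λ⁻¹`. -/
def residue (F : ℤ → MvPowerSeries σ K) : MvPowerSeries σ K := F (-1)

end Laurent

section BakerAkhiezer

variable {K : Type*} [CommRing K] [Algebra ℚ K]

/-- `exp (ε * ξ (t, λ))` with `ξ (t, λ) = ∑ n ≥ 1, t n * λ ^ n`. It is the sum over all exponents `m`
of `∏ l, (ε * t l * λ ^ l) ^ (m l) / (m l)!`, so the coefficient of `λ ^ k` collects the monomials
with `∑ l, l * m l = k`. -/
def expXi (ε : ℚ) : ℤ → Fn K := fun k m =>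
  if ((m.sum fun l e => (l : ℕ) * e : ℕ) : ℤ) = k then
    algebraMap ℚ K (m.prod fun _ e => ε ^ e / (e.factorial : ℚ))
  else 0

/-- The product of `exp (ε * ξ)` with a series bounded above in powers of `λ` is defined. -/
theorem mulDefined_expXi (F : ℤ → Fn K) (hF : ∃ N : ℤ, ∀ n : ℤ, N < n → F n = 0) (ε : ℚ) :
    MulDefined F (expXi ε) := by
  classical
  obtain ⟨N, hN⟩ := hF
  intro k m
  let wt : (ℕ+ →₀ ℕ) → ℕ := fun m => m.sum fun l e => (l : ℕ) * e
  obtain ⟨B, hB⟩ : ∃ B : ℕ, ∀ q ∈ Finset.HasAntidiagonal.antidiagonal m, wt q.2 ≤ B :=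
    ⟨(Finset.HasAntidiagonal.antidiagonal m).sup fun q => wt q.2,
      fun q hq => Finset.le_sup (f := fun q : (ℕ+ →₀ ℕ) × (ℕ+ →₀ ℕ) => wt q.2) hq⟩
  refine (Set.finite_Icc (k - B) N).subset fun i hi => ?_
  have h1 : i ≤ N := by
    by_contra hlt
    exact hi (by simp [hN i (by omega)])
  refine ⟨?_, h1⟩
  by_contra hlt
  refine hi ?_
  simp only [MvPowerSeries.coeff_mul]
  refine Finset.sum_eq_zero fun q hq => ?_
  have hz : MvPowerSeries.coeff q.2 (expXi (K := K) ε (k - i)) = 0 := by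
    refine if_neg fun h => ?_
    have h3 : ((wt q.2 : ℕ) : ℤ) = k - i := h
    have h4 := hB q hq
    omega
  rw [hz, mul_zero]

/-- The Baker-Akhiezer function `ψ (t, λ) = W (exp ξ) = (∑ i, w i * λ ^ (-i)) * exp (ξ (t, λ))`, as
`D ^ k (exp ξ) = λ ^ k * exp ξ`. -/
def psi (W : PDO K) : ℤ → Fn K := lmul W.coeff (expXi 1)

/-- The adjoint Baker-Akhiezer function `ψ* (t, λ) = (W*)⁻¹ (exp (-ξ))`, where
`D ^ k (exp (-ξ)) = (-λ) ^ k * exp (-ξ)`. -/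
def psiAdj (W : PDO K) : ℤ → Fn K :=
  lmul (fun k => (k.negOnePow : ℤ) • W.adj.inv.coeff k) (expXi (-1))

/-- The components `t l + ε * z ^ l / l` of `t + ε [z]`, where `z` stands for `λ⁻¹`. -/
def shiftTimes (K : Type*) [CommRing K] [Algebra ℚ K] (ε : ℚ) (l : ℕ+) :
    MvPowerSeries (ℕ+ ⊕ Unit) K :=
  MvPowerSeries.X (Sum.inl l) +
    MvPowerSeries.C (algebraMap ℚ K (ε / (l : ℕ))) * MvPowerSeries.X (Sum.inr ()) ^ (l : ℕ)

theorem hasSubst_shiftTimes (ε : ℚ) : MvPowerSeries.HasSubst (shiftTimes K ε) where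
  const_coeff l := by simp [shiftTimes]
  coeff_zero d := by
    classical
    refine (Set.Finite.union (d.support.finite_toSet.preimage
      (Sum.inl_injective.injOn)) (Set.finite_singleton
        ((d (Sum.inr ())).toPNat'))).subset fun l hl => ?_
    by_contra hcon
    simp only [Set.mem_union, Set.mem_preimage, Finset.mem_coe, Finsupp.mem_support_iff,
      Set.mem_singleton_iff, not_or, not_not] at hcon
    refine hl ?_
    rw [shiftTimes, map_add, MvPowerSeries.coeff_X, if_neg, MvPowerSeries.coeff_C_mul,
      MvPowerSeries.coeff_X_pow, if_neg, mul_zero, zero_add]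
    · rintro rfl
      exact hcon.2 (by simp)
    · rintro rfl
      simp at hcon

/-- `f (t + ε [λ⁻¹])` with `[λ⁻¹] = (λ⁻¹, λ⁻² / 2, λ⁻³ / 3, …)`, as a series in `λ`. -/
def shift (ε : ℚ) (f : Fn K) : ℤ → Fn K := fun k m =>
  if k ≤ 0 then
    MvPowerSeries.coeff (Finsupp.sumElim m (Finsupp.single () (-k).toNat))
      (MvPowerSeries.subst (shiftTimes K ε) f)
  else 0

/-- The spectral density `φ (λ) = λ⁻¹ ψ* (t, λ) Φ (t + [λ⁻¹])`. -/
def density (W : PDO K) (Φ : Fn K) : ℤ → Fn K := divLambda (lmul (psiAdj W) (shift 1 Φ))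

/-- The adjoint spectral density `φ* (λ) = λ⁻¹ ψ (t, λ) Ψ (t - [λ⁻¹])`. -/
def densityAdj (W : PDO K) (Ψ : Fn K) : ℤ → Fn K := divLambda (lmul (psi W) (shift (-1) Ψ))

/-- Functions of two multi-times `(t, t')`: `Sum.inl n` is the index of `t n`, `Sum.inr n` that of
`t' n`. -/
abbrev Fn2 (K : Type*) : Type _ := MvPowerSeries (ℕ+ ⊕ ℕ+) K

/-- `f (t)` as a function of `(t, t')`. -/
abbrev atT (f : Fn K) : Fn2 K := MvPowerSeries.rename (Function.Embedding.inl : ℕ+ ↪ ℕ+ ⊕ ℕ+) f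

/-- `f (t')` as a function of `(t, t')`. -/
abbrev atT' (f : Fn K) : Fn2 K := MvPowerSeries.rename (Function.Embedding.inr : ℕ+ ↪ ℕ+ ⊕ ℕ+) f

/-- The value at the multi-time `t' = 0`, as a constant function. -/
abbrev atZero (f : Fn K) : Fn K := MvPowerSeries.C (MvPowerSeries.constantCoeff f)

end BakerAkhiezer

end KP

end

/-! Both representations are instances of one statement about a `DressingPair`: a monic operator M
of order 0 with M N* = N* M = 1, a sign e, and differential operators C_n with ∂M/∂t_n = C_n M −
e^(n+1) M Dⁿ. For e = 1 take M = W, N = (W*)⁻¹, C_n = (L^(n/r))₊; for e = −1 exchange W and (W*)⁻¹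
and replace C_n by minus its adjoint. The wave function ψ = M(exp(eξ)) then satisfies ∂ψ/∂t_n = C_n
ψ.

Put z = λ⁻¹. Since exp(eξ(t + e[μ⁻¹], λ)) = (1 − λ/μ)⁻¹ exp(eξ(t, λ)), shifting the times of ψ
amounts to applying X(z) = M(t + e[z]) (1 − ezD)⁻¹ M⁻¹ = ∑ zⁿ X_n. Differentiating in z gives (n+1)
X_(n+1) = e ∑_(j+k=n) (∂_(j+1) X_k + X_k C_(j+1)) (`shiftOp_succ`). Hence every X_n is differential
(`isDiff_shiftOp`), and Φ(t + e[z]) = ∑ zⁿ X_n(Φ) for every Φ with ∂_n Φ = C_n Φ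
(`shiftHom_eq_plusApply`). The vanishing D⁻¹ coefficient of X_n says that the symbol of N at −eλ
inverts the symbol of M(t + e[z]) at eλ. It follows that the former times Φ(t + e[z]) equals ∑ (ez)ⁿ
(Dⁿ N*)₊(Φ) (`sum_dualSymbol_mul_shiftHom`).

On the diagonal t = t' the exponentials cancel, and the residue of the density times A(exp(eξ)) is
(A N*)₊(Φ) (`diag_spectralIntegral`). For A = XM with X differential this is X(Φ). So the defect
R_X(t, t') = ∫ φ(t') Xψ(t) − (XΦ)(t) vanishes for t = t', while ∂_n R_X = R_Y with Y = ∂_n X + X C_n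
again differential. A family closed under t-derivatives and zero on the diagonal is zero by Taylor
expansion (`eq_zero_of_closed_of_diag`). The case X = 1 is the representation; as the integral
equals Φ(t), it does not depend on t', and t' = 0 is allowed.

Two-sided series in λ are handled through `Tame` families, which `fromHahn` identifies with a
commutative ring of Laurent series in λ⁻¹. -/

noncomputable section

namespace KP

section

open Finset

/-! ### Iterated derivatives in x and their commutation with the flows. -/

section Derivative

variable {K : Type*} [CommRing K]

/-- The iterated derivative `∂ ^ k` as an additive map. -/
def dxHom (k : ℕ) : Fn K →+ Fn K where
  toFun f := dx^[k] f
  map_zero' := Function.iterate_fixed (map_zero (MvPowerSeries.pderiv K (1 : ℕ+))) k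
  map_add' f g := iterate_map_add (MvPowerSeries.pderiv K (1 : ℕ+)) k f g

theorem dx_iterate (k : ℕ) (f : Fn K) : dx^[k] f = dxHom k f := rfl

@[simp] theorem dxHom_zero (f : Fn K) : dxHom 0 f = f := rfl

theorem dxHom_succ (k : ℕ) (f : Fn K) : dxHom (k + 1) f = dx (dxHom k f) :=
  Function.iterate_succ_apply' _ _ _

theorem dxHom_succ' (k : ℕ) (f : Fn K) : dxHom (k + 1) f = dxHom k (dx f) :=
  Function.iterate_succ_apply _ _ _

theorem dxHom_dxHom (k l : ℕ) (f : Fn K) : dxHom k (dxHom l f) = dxHom (k + l) f :=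
  (Function.iterate_add_apply _ k l f).symm

theorem dx_mul (f g : Fn K) : dx (f * g) = f * dx g + dx f * g := by
  simp [dx, Derivation.leibniz, mul_comm]

theorem dxHom_mul (n : ℕ) (f g : Fn K) :
    dxHom n (f * g) = ∑ p ∈ antidiagonal n, n.choose p.1 • (dxHom p.1 f * dxHom p.2 g) := by
  induction n with
  | zero => simp
  | succ n ih =>
    rw [dxHom_succ, ih, sum_antidiagonal_choose_succ_nsmul
      (fun i j => dxHom i f * dxHom j g) n, ← sum_add_distrib]
    simp only [dx, map_sum, map_nsmul]
    refine sum_congr rfl fun p hp => ?_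
    have h : n.choose p.1 = n.choose p.2 :=
      Nat.choose_symm_of_eq_add (HasAntidiagonal.mem_antidiagonal.mp hp).symm
    change _ • dx _ = _
    rw [dx_mul, smul_add, ← dxHom_succ, ← dxHom_succ, h]

theorem dxHom_one_succ (k : ℕ) : dxHom (k + 1) (1 : Fn K) = 0 := by
  rw [dxHom_succ']
  simp [dx]

theorem pderiv_comm {σ : Type*} (i j : σ) (f : MvPowerSeries σ K) :
    MvPowerSeries.pderiv K i (MvPowerSeries.pderiv K j f) =
      MvPowerSeries.pderiv K j (MvPowerSeries.pderiv K i f) := by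
  ext a
  simp only [MvPowerSeries.coeff_pderiv]
  by_cases h : i = j
  · subst h; rfl
  · rw [add_right_comm]
    simp [h, Ne.symm h, mul_right_comm]

theorem dt_comm (m n : ℕ+) (f : Fn K) : dt m (dt n f) = dt n (dt m f) := pderiv_comm m n f

theorem dt_dxHom (n : ℕ+) (k : ℕ) (f : Fn K) : dt n (dxHom k f) = dxHom k (dt n f) := by
  induction k with
  | zero => rfl
  | succ k ih => rw [dxHom_succ, dxHom_succ, dt_comm, ih]

end Derivative

/-! ### The ring of pseudo-differential operators and its order filtration. -/

namespace PDO

variable {K : Type*} [CommRing K]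

theorem coeff_injective : Function.Injective (coeff : PDO K → ℤ → Fn K) :=
  fun _ _ h => PDO.ext h

instance : Add (PDO K) where
  add A B :=
    { coeff := fun n => A.coeff n + B.coeff n
      bdd := by
        obtain ⟨N, hN⟩ := A.bdd
        obtain ⟨M, hM⟩ := B.bdd
        exact ⟨max N M, fun n hn => by
          rw [hN n (lt_of_le_of_lt (le_max_left _ _) hn),
            hM n (lt_of_le_of_lt (le_max_right _ _) hn), add_zero]⟩ }

instance : Neg (PDO K) where
  neg A :=
    { coeff := fun n => -A.coeff n
      bdd := by
        obtain ⟨N, hN⟩ := A.bdd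
        exact ⟨N, fun n hn => by rw [hN n hn, neg_zero]⟩ }

/-- Multiplication of all coefficients by an element of a monoid acting on functions. -/
instance {R : Type*} [SMulZeroClass R (Fn K)] : SMul R (PDO K) where
  smul c A :=
    { coeff := fun n => c • A.coeff n
      bdd := by
        obtain ⟨N, hN⟩ := A.bdd
        exact ⟨N, fun n hn => by rw [hN n hn, smul_zero]⟩ }

@[simp] theorem coeff_zero (n : ℤ) : (0 : PDO K).coeff n = 0 := rfl

@[simp] theorem coeff_add (A B : PDO K) (n : ℤ) : (A + B).coeff n = A.coeff n + B.coeff n := rfl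

@[simp] theorem coeff_sub (A B : PDO K) (n : ℤ) : (A - B).coeff n = A.coeff n - B.coeff n := rfl

@[simp] theorem coeff_neg (A : PDO K) (n : ℤ) : (-A).coeff n = -A.coeff n := rfl

@[simp] theorem coeff_smul {R : Type*} [SMulZeroClass R (Fn K)] (c : R) (A : PDO K) (n : ℤ) :
    (c • A).coeff n = c • A.coeff n := rfl

instance : AddCommGroup (PDO K) :=
  coeff_injective.addCommGroup coeff rfl (fun _ _ => rfl) (fun _ => rfl) (fun _ _ => rfl)
    (fun _ _ => rfl) (fun _ _ => rfl)

/-- The coefficient of `D ^ n` as an additive map. -/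
def coeffHom (n : ℤ) : PDO K →+ Fn K where
  toFun A := A.coeff n
  map_zero' := rfl
  map_add' _ _ := rfl

theorem coeff_sum {ι : Type*} (s : Finset ι) (A : ι → PDO K) (n : ℤ) :
    (∑ i ∈ s, A i).coeff n = ∑ i ∈ s, (A i).coeff n :=
  map_sum (coeffHom n) A s

/-- The operator has order at most `N`. -/
def OrdLE (A : PDO K) (N : ℤ) : Prop := ∀ n, N < n → A.coeff n = 0

theorem exists_ordLE (A : PDO K) : ∃ N, A.OrdLE N := A.bdd

theorem OrdLE.mono {A : PDO K} {N M : ℤ} (h : A.OrdLE N) (hNM : N ≤ M) : A.OrdLE M :=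
  fun n hn => h n (by omega)

theorem OrdLE.add {A B : PDO K} {N : ℤ} (hA : A.OrdLE N) (hB : B.OrdLE N) : (A + B).OrdLE N :=
  fun n hn => by rw [coeff_add, hA n hn, hB n hn, add_zero]

theorem OrdLE.sub {A B : PDO K} {N : ℤ} (hA : A.OrdLE N) (hB : B.OrdLE N) : (A - B).OrdLE N :=
  fun n hn => by rw [coeff_sub, hA n hn, hB n hn, sub_zero]

theorem OrdLE.sum {ι : Type*} {s : Finset ι} {A : ι → PDO K} {N : ℤ}
    (h : ∀ i ∈ s, (A i).OrdLE N) : (∑ i ∈ s, A i).OrdLE N :=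
  fun n hn => by rw [coeff_sum]; exact sum_eq_zero fun i hi => h i hi n hn

theorem OrdLE.smul {R : Type*} [SMulZeroClass R (Fn K)] {A : PDO K} {N : ℤ} (hA : A.OrdLE N)
    (c : R) : (c • A).OrdLE N :=
  fun n hn => by rw [coeff_smul, hA n hn, smul_zero]

theorem eq_zero_of_ordLE {A : PDO K} (h : ∀ N : ℕ, A.OrdLE (-N)) : A = 0 := by
  ext1
  funext n
  exact h ((-n).toNat + 1) n (by push_cast; omega)

theorem ext_of_ordLE {A B : PDO K} {N : ℤ} (hA : A.OrdLE N) (hB : B.OrdLE N)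
    (h : ∀ s : ℕ, A.coeff (N - s) = B.coeff (N - s)) : A = B := by
  ext1
  funext n
  by_cases hn : N < n
  · rw [hA n hn, hB n hn]
  · have := h (N - n).toNat
    rwa [show N - ((N - n).toNat : ℤ) = n by omega] at this

/-- The operator `a * D ^ i`. -/
def mono (a : Fn K) (i : ℤ) : PDO K where
  coeff k := if k = i then a else 0
  bdd := ⟨i, fun k hk => if_neg (by omega)⟩

theorem coeff_mono (a : Fn K) (i n : ℤ) : (mono a i).coeff n = if n = i then a else 0 := rfl

@[simp] theorem coeff_mono_self (a : Fn K) (i : ℤ) : (mono a i).coeff i = a := if_pos rfl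

theorem mono_one (i : ℤ) : mono (1 : Fn K) i = D i := rfl

theorem D_zero : (D 0 : PDO K) = 1 := rfl

theorem ordLE_mono (a : Fn K) (i : ℤ) : (mono a i).OrdLE i := fun n hn => if_neg (by omega)

theorem ordLE_D (i : ℤ) : (D i : PDO K).OrdLE i := fun n hn => if_neg (by omega)

theorem exists_sum_mono (A : PDO K) (M : ℤ) :
    ∃ s : Finset ℤ, (A - ∑ i ∈ s, mono (A.coeff i) i).OrdLE M := by
  obtain ⟨N, hN⟩ := A.exists_ordLE
  refine ⟨Finset.Icc (M + 1) N, fun n hn => ?_⟩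
  simp only [coeff_sub, coeff_sum, coeff_mono, Finset.sum_ite_eq, Finset.mem_Icc]
  split_ifs with h
  · simp
  · rw [hN n (by omega), sub_zero]

/-- An additive map that ignores terms of sufficiently low order is determined by its values on
monomials. -/
theorem addHom_eq_zero (F : PDO K →+ Fn K) (hF : ∃ M, ∀ A : PDO K, A.OrdLE M → F A = 0)
    (hm : ∀ a i, F (mono a i) = 0) (A : PDO K) : F A = 0 := by
  obtain ⟨M, hM⟩ := hF
  obtain ⟨s, hs⟩ := A.exists_sum_mono M
  have := hM _ hs
  rwa [map_sub, map_sum, Finset.sum_eq_zero fun i _ => hm _ i, sub_zero] at this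

theorem coeff_mul (A B : PDO K) (n : ℤ) : (A * B).coeff n = ∑ᶠ p : ℤ × ℕ,
    (Ring.choose p.1 p.2 : ℤ) • (A.coeff p.1 * dxHom p.2 (B.coeff (n - p.1 + p.2))) := rfl

theorem OrdLE.mul {A B : PDO K} {N M : ℤ} (hA : A.OrdLE N) (hB : B.OrdLE M) :
    (A * B).OrdLE (N + M) := fun n hn => by
  rw [coeff_mul, ← finsum_zero (α := ℤ × ℕ)]
  refine finsum_congr fun p => ?_
  by_cases h : N < p.1
  · simp [hA p.1 h]
  · rw [hB (n - p.1 + p.2) (by omega), map_zero, mul_zero, smul_zero]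

protected theorem add_mul (A B C : PDO K) : (A + B) * C = A * C + B * C := by
  ext1; funext n
  refine Eq.trans ?_ (finsum_add_distrib (mul_support_finite A C n) (mul_support_finite B C n))
  refine finsum_congr fun p => ?_
  rw [dx_iterate, coeff_add, add_mul, smul_add]

protected theorem mul_add (A B C : PDO K) : A * (B + C) = A * B + A * C := by
  ext1; funext n
  refine Eq.trans ?_ (finsum_add_distrib (mul_support_finite A B n) (mul_support_finite A C n))
  refine finsum_congr fun p => ?_
  rw [dx_iterate, coeff_add, map_add, mul_add, smul_add]
  rfl

protected theorem zero_mul (A : PDO K) : 0 * A = 0 := by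
  have := PDO.add_mul 0 0 A
  rwa [add_zero, left_eq_add] at this

protected theorem mul_zero (A : PDO K) : A * 0 = 0 := by
  have := PDO.mul_add A 0 0
  rwa [add_zero, left_eq_add] at this

theorem coeff_mul_mono {A : PDO K} {N : ℤ} (hA : A.OrdLE N) (c : Fn K) (l : ℤ) (s : ℕ) :
    (A * mono c l).coeff (N + l - s) = ∑ p ∈ antidiagonal s,
      (Ring.choose (N - p.1) p.2 : ℤ) • (A.coeff (N - p.1) * dxHom p.2 c) := by
  have hinj : Function.Injective fun p : ℕ × ℕ => ((N - p.1, p.2) : ℤ × ℕ) := by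
    rintro ⟨a, b⟩ ⟨a', b'⟩ h
    simp only [Prod.mk.injEq] at h ⊢
    omega
  rw [coeff_mul, finsum_eq_finsetSum_of_support_subset
    (s := (antidiagonal s).image fun p : ℕ × ℕ => ((N - p.1, p.2) : ℤ × ℕ)),
    sum_image hinj.injOn]
  · refine sum_congr rfl fun p hp => ?_
    have := HasAntidiagonal.mem_antidiagonal.mp hp
    rw [coeff_mono, if_pos (by omega)]
  · rintro ⟨i, k⟩ h
    simp only [coe_image, Set.mem_image, mem_coe, HasAntidiagonal.mem_antidiagonal, Prod.mk.injEq, Prod.exists]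
    have h1 : i ≤ N := by
      by_contra hlt
      exact h (by simp [hA i (by omega)])
    have h2 : N + l - s - i + k = l := by
      by_contra hne
      refine h ?_
      simp only [coeff_mono, if_neg hne, map_zero, mul_zero, smul_zero]
    exact ⟨(N - i).toNat, k, by omega, by omega, rfl⟩

theorem coeff_mono_mul {B : PDO K} {M : ℤ} (hB : B.OrdLE M) (a : Fn K) (i : ℤ) (s : ℕ) :
    (mono a i * B).coeff (i + M - s) = ∑ p ∈ antidiagonal s,
      (Ring.choose i p.1 : ℤ) • (a * dxHom p.1 (B.coeff (M - p.2))) := by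
  have hinj : Set.InjOn (fun p : ℕ × ℕ => ((i, p.1) : ℤ × ℕ)) (antidiagonal s : Set (ℕ × ℕ)) := by
    rintro ⟨a, b⟩ h1 ⟨a', b'⟩ h2 h
    simp only [Prod.mk.injEq, mem_coe, HasAntidiagonal.mem_antidiagonal] at h h1 h2 ⊢
    omega
  rw [coeff_mul, finsum_eq_finsetSum_of_support_subset
    (s := (antidiagonal s).image fun p : ℕ × ℕ => ((i, p.1) : ℤ × ℕ)),
    sum_image hinj]
  · refine sum_congr rfl fun p hp => ?_
    have := HasAntidiagonal.mem_antidiagonal.mp hp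
    rw [coeff_mono_self, show i + M - (s : ℤ) - i + (p.1 : ℤ) = M - p.2 by omega]
  · rintro ⟨j, k⟩ h
    simp only [coe_image, Set.mem_image, mem_coe, HasAntidiagonal.mem_antidiagonal, Prod.mk.injEq, Prod.exists]
    have h1 : j = i := by
      by_contra hne
      exact h (by simp [coeff_mono, if_neg hne])
    subst h1
    have h2 : j + M - s - j + k ≤ M := by
      by_contra hlt
      refine h ?_
      simp only [hB _ (not_le.mp hlt), map_zero, mul_zero, smul_zero]
    exact ⟨k, s - k, by omega, rfl, rfl⟩

theorem coeff_mono_mul_mono (a b : Fn K) (i j : ℤ) (s : ℕ) :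
    (mono a i * mono b j).coeff (i + j - s) = (Ring.choose i s : ℤ) • (a * dxHom s b) := by
  rw [coeff_mul_mono (ordLE_mono a i), sum_eq_single (0, s)]
  · simp
  · rintro ⟨x, y⟩ hxy hne
    have hxy := HasAntidiagonal.mem_antidiagonal.mp hxy
    have hx : ¬ (i - (x : ℤ) = i) := by
      rintro h
      exact hne (by simp_all)
    rw [coeff_mono, if_neg hx, zero_mul, smul_zero]
  · simp

theorem _root_.KP.sum_antidiagonal_assoc {M : Type*} [AddCommMonoid M] (s : ℕ)
    (f : ℕ → ℕ → ℕ → M) :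
    ∑ p ∈ antidiagonal s, ∑ q ∈ antidiagonal p.1, f q.1 q.2 p.2 =
      ∑ p ∈ antidiagonal s, ∑ q ∈ antidiagonal p.2, f p.1 q.1 q.2 := by
  rw [sum_sigma', sum_sigma']
  refine sum_nbij' (fun x => ⟨(x.2.1, x.2.2 + x.1.2), (x.2.2, x.1.2)⟩)
    (fun x => ⟨(x.1.1 + x.2.1, x.2.2), (x.1.1, x.2.1)⟩) ?_ ?_ ?_ ?_ ?_ <;>
  · rintro ⟨⟨a, b⟩, c, d⟩ h
    simp only [mem_sigma, HasAntidiagonal.mem_antidiagonal] at h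
    obtain ⟨h1, rfl⟩ := h
    first
      | rfl
      | simp only [mem_sigma, HasAntidiagonal.mem_antidiagonal]
        exact ⟨by omega, trivial⟩

theorem _root_.KP.choose_mul_choose (i : ℤ) (x z : ℕ) :
    Ring.choose i (x + z) * ((x + z).choose x : ℤ) = Ring.choose i x * Ring.choose (i - x) z := by
  have := Ring.choose_smul_choose i (Nat.le_add_right x z)
  rw [Nat.add_sub_cancel_left, nsmul_eq_mul] at this
  rw [← this, mul_comm]

theorem _root_.KP.sum_choose_mul_choose (i j : ℤ) (x t : ℕ) :
    ∑ q ∈ antidiagonal t, Ring.choose (i - x) q.1 * Ring.choose j q.2 =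
      Ring.choose (i + j - x) t := by
  rw [show i + j - x = (i - x) + j by ring, Ring.add_choose_eq t (Commute.all _ _)]

/-- By the Leibniz rule both sides are combinations of a · ∂^x b · ∂^y c. The coefficients agree by
(i choose x+z)(x+z choose x) = (i choose x)(i−x choose z) and the Vandermonde identity, both valid
for integer upper entries. -/
theorem mono_mul_mono_assoc (a b c : Fn K) (i j l : ℤ) :
    mono a i * mono b j * mono c l = mono a i * (mono b j * mono c l) := by
  have hab := (ordLE_mono a i).mul (ordLE_mono b j)
  have hbc := (ordLE_mono b j).mul (ordLE_mono c l)
  refine ext_of_ordLE (hab.mul (ordLE_mono c l))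
    (by rw [add_assoc]; exact (ordLE_mono a i).mul hbc) fun s => ?_
  rw [coeff_mul_mono hab, add_assoc i j l, coeff_mono_mul hbc]
  simp only [coeff_mono_mul_mono, map_zsmul, dxHom_mul, smul_sum, mul_sum, dxHom_dxHom]
  refine Eq.trans ?_ ((sum_congr rfl fun p _ => sum_congr rfl fun q hq => ?_).trans
    (sum_antidiagonal_assoc s fun x z y => ((Ring.choose i (x + z) * ((x + z).choose x : ℤ)) *
      Ring.choose j y) • (a * (dxHom x b * dxHom (z + y) c)))).symm
  · refine sum_congr rfl fun p _ => ?_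
    have : ∀ q ∈ antidiagonal p.2, ((Ring.choose i (p.1 + q.1) * ((p.1 + q.1).choose p.1 : ℤ)) *
        Ring.choose j q.2) • (a * (dxHom p.1 b * dxHom (q.1 + q.2) c)) =
        (Ring.choose i p.1 * (Ring.choose (i - p.1) q.1 * Ring.choose j q.2)) •
          (a * (dxHom p.1 b * dxHom p.2 c)) := fun q hq => by
      rw [HasAntidiagonal.mem_antidiagonal.mp hq, choose_mul_choose, mul_assoc]
    rw [sum_congr rfl this, ← sum_smul, ← mul_sum, sum_choose_mul_choose, smul_mul_assoc,
      smul_smul, mul_comm (Ring.choose _ _), mul_assoc a]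
  · rw [← HasAntidiagonal.mem_antidiagonal.mp hq]
    simp only [mul_smul_comm, ← natCast_zsmul, smul_smul]
    congr 1
    ring

/-- A fixed coefficient of the associator is additive in each argument and blind to terms of low
enough order, so the three arguments can be replaced by monomials one after another. -/
protected theorem mul_assoc (A B C : PDO K) : A * B * C = A * (B * C) := by
  rw [← sub_eq_zero]
  ext1; funext n
  obtain ⟨NA, hA⟩ := A.exists_ordLE
  obtain ⟨NB, hB⟩ := B.exists_ordLE
  obtain ⟨NC, hC⟩ := C.exists_ordLE
  have hvan : ∀ A B C : PDO K, (∃ a b c, A.OrdLE a ∧ B.OrdLE b ∧ C.OrdLE c ∧ a + b + c < n) →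
      (A * B * C - A * (B * C)).coeff n = 0 := by
    rintro A B C ⟨a, b, c, ha, hb, hc, h⟩
    rw [coeff_sub, ((ha.mul hb).mul hc) n h, (ha.mul (hb.mul hc)) n (by omega), sub_zero]
  let F (B C : PDO K) : PDO K →+ Fn K := AddMonoidHom.mk'
    (fun A => (A * B * C - A * (B * C)).coeff n) fun A A' => by
      simp only [PDO.add_mul, coeff_sub, coeff_add]; abel
  let G (A C : PDO K) : PDO K →+ Fn K := AddMonoidHom.mk'
    (fun B => (A * B * C - A * (B * C)).coeff n) fun B B' => by
      simp only [PDO.add_mul, PDO.mul_add, coeff_sub, coeff_add]; abel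
  let H (A B : PDO K) : PDO K →+ Fn K := AddMonoidHom.mk'
    (fun C => (A * B * C - A * (B * C)).coeff n) fun C C' => by
      simp only [PDO.mul_add, coeff_sub, coeff_add]; abel
  refine addHom_eq_zero (F B C) ⟨n - NB - NC - 1, fun A' hA' =>
    hvan _ _ _ ⟨_, _, _, hA', hB, hC, by omega⟩⟩ (fun a i => ?_) A
  refine addHom_eq_zero (G (mono a i) C) ⟨n - i - NC - 1, fun B' hB' =>
    hvan _ _ _ ⟨_, _, _, ordLE_mono a i, hB', hC, by omega⟩⟩ (fun b j => ?_) B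
  refine addHom_eq_zero (H (mono a i) (mono b j)) ⟨n - i - j - 1, fun C' hC' =>
    hvan _ _ _ ⟨_, _, _, ordLE_mono a i, ordLE_mono b j, hC', by omega⟩⟩ (fun c l => ?_) C
  change (_ - _ : PDO K).coeff n = 0
  rw [mono_mul_mono_assoc, sub_self, coeff_zero]

theorem coeff_mul_D (A : PDO K) (i n : ℤ) : (A * D i).coeff n = A.coeff (n - i) := by
  obtain ⟨N, hN⟩ := A.exists_ordLE
  rw [← mono_one]
  by_cases hn : N + i < n
  · rw [(hN.mul (ordLE_mono 1 i)) n hn, hN _ (by omega)]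
  · obtain ⟨s, rfl⟩ : ∃ s : ℕ, n = N + i - s := ⟨(N + i - n).toNat, by omega⟩
    rw [coeff_mul_mono hN, sum_eq_single (s, 0)]
    · simp only [dxHom_zero, mul_one, Ring.choose_zero_right, one_smul]
      congr 1; omega
    · rintro ⟨x, y⟩ hxy hne
      have hxy := HasAntidiagonal.mem_antidiagonal.mp hxy
      obtain ⟨k, rfl⟩ : ∃ k, y = k + 1 :=
        Nat.exists_eq_succ_of_ne_zero (by rintro rfl; exact hne (by simp_all))
      rw [dxHom_one_succ, mul_zero, smul_zero]
    · simp

theorem coeff_mono_zero_mul (a : Fn K) (B : PDO K) (n : ℤ) :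
    (mono a 0 * B).coeff n = a * B.coeff n := by
  obtain ⟨N, hN⟩ := B.exists_ordLE
  by_cases hn : N < n
  · rw [((ordLE_mono a 0).mul hN) n (by omega), hN n hn, mul_zero]
  · obtain ⟨s, rfl⟩ : ∃ s : ℕ, n = 0 + N - s := ⟨(N - n).toNat, by omega⟩
    rw [coeff_mono_mul hN, sum_eq_single (0, s)]
    · simp
    · rintro ⟨x, y⟩ hxy hne
      have hxy := HasAntidiagonal.mem_antidiagonal.mp hxy
      rw [Ring.choose_zero_pos, zero_smul]
      exact Nat.pos_of_ne_zero (by rintro rfl; exact hne (by simp_all))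
    · simp

protected theorem mul_one (A : PDO K) : A * 1 = A := by
  ext1; funext n
  rw [← D_zero, coeff_mul_D, sub_zero]

protected theorem one_mul (A : PDO K) : 1 * A = A := by
  ext1; funext n
  rw [← D_zero, ← mono_one, coeff_mono_zero_mul, one_mul]

instance : Ring (PDO K) where
  __ := (inferInstance : AddCommGroup (PDO K))
  left_distrib := PDO.mul_add
  right_distrib := PDO.add_mul
  zero_mul := PDO.zero_mul
  mul_zero := PDO.mul_zero
  mul_assoc := PDO.mul_assoc
  one_mul := PDO.one_mul
  mul_one := PDO.mul_one
  npow n A := A ^ n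
  npow_zero _ := rfl
  npow_succ _ _ := rfl

theorem mono_mul_D (a : Fn K) (i j : ℤ) : mono a i * D j = mono a (i + j) := by
  ext1; funext n
  rw [coeff_mul_D, coeff_mono, coeff_mono]
  exact if_congr (by omega) rfl rfl

theorem mono_eq (a : Fn K) (i : ℤ) : mono a i = mono a 0 * D i := by rw [mono_mul_D, zero_add]

theorem D_mul_D (i j : ℤ) : (D i * D j : PDO K) = D (i + j) := by
  rw [← mono_one, mono_mul_D, mono_one]

theorem ordLE_one : (1 : PDO K).OrdLE 0 := ordLE_D 0

theorem OrdLE.pow {A : PDO K} {N : ℤ} (hA : A.OrdLE N) (k : ℕ) : (A ^ k).OrdLE (k * N) := by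
  induction k with
  | zero => simpa using ordLE_one
  | succ k ih =>
    rw [pow_succ, Nat.cast_succ, add_one_mul (k : ℤ)]
    exact ih.mul hA

end PDO

/-- Binomial expansion of (∂ − ∂_b)^s, where ∂ differentiates the whole product and ∂_b only the
factor b; the difference differentiates a alone. This is the identity behind the adjoint of a Dⁱ ∘
b. -/
theorem sum_neg_choose_dxHom {K : Type*} [CommRing K] (s : ℕ) (a b : Fn K) :
    ∑ p ∈ antidiagonal s, s.choose p.1 • ((-1 : ℤ) ^ p.1 • dxHom p.2 (a * dxHom p.1 b)) =
      dxHom s a * b := by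
  induction s generalizing b with
  | zero => simp
  | succ s ih =>
    rw [sum_antidiagonal_choose_succ_nsmul
      (fun i j => (-1 : ℤ) ^ i • dxHom j (a * dxHom i b)) s]
    have h1 : ∑ p ∈ antidiagonal s, s.choose p.1 •
        ((-1 : ℤ) ^ p.1 • dxHom (p.2 + 1) (a * dxHom p.1 b)) = dx (dxHom s a * b) := by
      rw [← ih b]
      simp only [dx, map_sum, map_nsmul, map_zsmul, dxHom_succ]
    have h2 : ∑ p ∈ antidiagonal s, s.choose p.2 •
        ((-1 : ℤ) ^ (p.1 + 1) • dxHom p.2 (a * dxHom (p.1 + 1) b)) = -(dxHom s a * dx b) := by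
      rw [← ih (dx b), ← sum_neg_distrib]
      refine sum_congr rfl fun p hp => ?_
      rw [Nat.choose_symm_of_eq_add (HasAntidiagonal.mem_antidiagonal.mp hp).symm, dxHom_succ',
        pow_succ, mul_neg_one, neg_smul, smul_neg]
    rw [h1, h2, dx_mul, dxHom_succ]
    abel

/-! ### The formal adjoint as an anti-involution. -/

namespace PDO

variable {K : Type*} [CommRing K]

theorem coeff_adj (A : PDO K) (n : ℤ) : A.adj.coeff n =
    ∑ᶠ k : ℕ, (((n + k).negOnePow : ℤ) * Ring.choose (n + k) k) •
      dxHom k (A.coeff (n + k)) := rfl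

theorem coeff_adj_of_ordLE {A : PDO K} {N : ℤ} (hA : A.OrdLE N) (s : ℕ) :
    A.adj.coeff (N - s) = ∑ p ∈ antidiagonal s,
      (((N - p.1).negOnePow : ℤ) * Ring.choose (N - p.1) p.2) •
        dxHom p.2 (A.coeff (N - p.1)) := by
  have hinj : Set.InjOn (fun p : ℕ × ℕ => p.2) (antidiagonal s : Set (ℕ × ℕ)) := by
    rintro ⟨a, b⟩ h1 ⟨a', b'⟩ h2 h
    simp only [Prod.mk.injEq, mem_coe, HasAntidiagonal.mem_antidiagonal] at h h1 h2 ⊢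
    omega
  rw [coeff_adj, finsum_eq_finsetSum_of_support_subset
    (s := (antidiagonal s).image fun p : ℕ × ℕ => p.2), sum_image hinj]
  · refine sum_congr rfl fun p hp => ?_
    have := HasAntidiagonal.mem_antidiagonal.mp hp
    rw [show N - (s : ℤ) + (p.2 : ℤ) = N - p.1 by omega]
  · intro k h
    simp only [coe_image, Set.mem_image, mem_coe, HasAntidiagonal.mem_antidiagonal, Prod.exists]
    have h1 : N - s + k ≤ N := by
      by_contra hlt
      refine h ?_
      simp only [hA _ (not_le.mp hlt), map_zero, smul_zero]
    exact ⟨s - k, k, by omega, rfl⟩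

theorem OrdLE.adj {A : PDO K} {N : ℤ} (hA : A.OrdLE N) : A.adj.OrdLE N := fun n hn => by
  rw [coeff_adj, ← finsum_zero (α := ℕ)]
  refine finsum_congr fun k => ?_
  rw [hA _ (by omega), map_zero, smul_zero]

theorem adj_add (A B : PDO K) : (A + B).adj = A.adj + B.adj := by
  obtain ⟨N, hN⟩ := A.exists_ordLE
  obtain ⟨M, hM⟩ := B.exists_ordLE
  have hA := hN.mono (le_max_left N M)
  have hB := hM.mono (le_max_right N M)
  refine ext_of_ordLE (hA.add hB).adj (hA.adj.add hB.adj) fun s => ?_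
  rw [coeff_add, coeff_adj_of_ordLE (hA.add hB), coeff_adj_of_ordLE hA, coeff_adj_of_ordLE hB,
    ← sum_add_distrib]
  simp only [coeff_add, map_add, smul_add]

/-- The formal adjoint as an additive map. -/
def adjHom : PDO K →+ PDO K := AddMonoidHom.mk' adj adj_add

theorem adj_zsmul (c : ℤ) (A : PDO K) : (c • A).adj = c • A.adj := map_zsmul adjHom c A

theorem adj_sub (A B : PDO K) : (A - B).adj = A.adj - B.adj := map_sub adjHom A B

/-- Two additive maps between operators that respect the order filtration and agree on monomials
coincide. -/
theorem addHom_ext {F G : PDO K →+ PDO K} (d : ℤ)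
    (hF : ∀ (A : PDO K) N, A.OrdLE N → (F A).OrdLE (N + d))
    (hG : ∀ (A : PDO K) N, A.OrdLE N → (G A).OrdLE (N + d))
    (hm : ∀ a i, F (mono a i) = G (mono a i)) (A : PDO K) : F A = G A := by
  rw [← sub_eq_zero]
  ext1; funext n
  refine addHom_eq_zero ((coeffHom n).comp (F - G)) ⟨n - d - 1, fun B hB => ?_⟩ (fun a i => ?_) A
  · exact ((hF B _ hB).sub (hG B _ hB)) n (by omega)
  · change (F (mono a i) - G (mono a i)).coeff n = 0
    rw [hm, sub_self, coeff_zero]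

theorem adj_mono (a : Fn K) (i : ℤ) :
    (mono a i).adj = (i.negOnePow : ℤ) • (D i * mono a 0) := by
  have h : (D i * mono a 0).OrdLE i := by simpa using (ordLE_D i).mul (ordLE_mono a 0)
  refine ext_of_ordLE (ordLE_mono a i).adj (h.smul _) fun s => ?_
  rw [coeff_adj_of_ordLE (ordLE_mono a i), sum_eq_single (0, s)]
  · have := coeff_mono_mul_mono 1 a i 0 s
    rw [add_zero] at this
    rw [coeff_smul, ← mono_one, this]
    simp [mul_smul]
  · rintro ⟨x, y⟩ hxy hne
    have hxy := HasAntidiagonal.mem_antidiagonal.mp hxy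
    rw [coeff_mono, if_neg, map_zero, smul_zero]
    intro h
    have : x = 0 := by omega
    exact hne (by simp_all)
  · simp

theorem adj_mono_zero (a : Fn K) : (mono a 0).adj = mono a 0 := by
  rw [adj_mono, D_zero, one_mul]
  simp

theorem adj_mul_D (A : PDO K) (j : ℤ) : (A * D j).adj = (j.negOnePow : ℤ) • (D j * A.adj) := by
  refine addHom_ext (F := adjHom.comp (AddMonoidHom.mulRight (D j)))
    (G := (j.negOnePow : ℤ) • (AddMonoidHom.mulLeft (D j)).comp adjHom) j
    (fun A N hA => (hA.mul (ordLE_D j)).adj)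
    (fun A N hA => by
      rw [add_comm N j]
      exact OrdLE.smul (A := D j * A.adj) ((ordLE_D j).mul hA.adj) (j.negOnePow : ℤ)) ?_ A
  intro a i
  change (mono a i * D j).adj = (j.negOnePow : ℤ) • (D j * (mono a i).adj)
  rw [mono_mul_D, adj_mono, adj_mono, mul_smul_comm, smul_smul, ← mul_assoc, D_mul_D,
    Int.negOnePow_add, Units.val_mul, mul_comm (j.negOnePow : ℤ), add_comm]

theorem adj_mono_mul_mono_zero (a b : Fn K) (i : ℤ) :
    (mono a i * mono b 0).adj = mono b 0 * (mono a i).adj := by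
  have h : (mono a i * mono b 0).OrdLE i := by
    simpa using (ordLE_mono a i).mul (ordLE_mono b 0)
  have h' : (mono b 0 * (mono a i).adj).OrdLE i := by
    simpa using (ordLE_mono b 0).mul (ordLE_mono a i).adj
  refine ext_of_ordLE h.adj h' fun s => ?_
  have e1 := fun t => coeff_mono_mul_mono a b i 0 t
  have e2 := coeff_mono_mul_mono 1 a i 0 s
  rw [add_zero] at e1 e2
  rw [coeff_adj_of_ordLE h, coeff_mono_zero_mul, adj_mono, coeff_smul, ← mono_one, e2, one_mul,
    mul_smul_comm, mul_smul_comm, mul_comm b, ← sum_neg_choose_dxHom, smul_sum, smul_sum]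
  refine sum_congr rfl fun p hp => ?_
  have hs := HasAntidiagonal.mem_antidiagonal.mp hp
  have hc : Ring.choose i s * (s.choose p.1 : ℤ) =
      Ring.choose i p.1 * Ring.choose (i - p.1) p.2 := by
    rw [← choose_mul_choose, hs]
  have hn : ((i - p.1).negOnePow : ℤ) = (i.negOnePow : ℤ) * (-1) ^ p.1 := by
    rw [Int.negOnePow_sub, Units.val_mul]
    simp [Int.negOnePow_def]
  rw [e1, map_zsmul, hn]
  simp only [← natCast_zsmul, smul_smul]
  congr 1
  linear_combination (-(i.negOnePow : ℤ) * (-1) ^ p.1) * hc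

theorem adj_mul_mono_zero (A : PDO K) (b : Fn K) :
    (A * mono b 0).adj = mono b 0 * A.adj := by
  refine addHom_ext (F := adjHom.comp (AddMonoidHom.mulRight (mono b 0)))
    (G := (AddMonoidHom.mulLeft (mono b 0)).comp adjHom) 0
    (fun A N hA => (hA.mul (ordLE_mono b 0)).adj)
    (fun A N hA => (add_comm 0 N ▸ (ordLE_mono b 0).mul hA.adj :)) ?_ A
  exact fun a i => adj_mono_mul_mono_zero a b i

/-- For fixed A it suffices to take B = b Dʲ, a multiplication operator times a power of D; the
adjoints of the two right factors are peeled off separately. -/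
theorem adj_mul (A B : PDO K) : (A * B).adj = B.adj * A.adj := by
  obtain ⟨N, hN⟩ := A.exists_ordLE
  refine addHom_ext (F := adjHom.comp (AddMonoidHom.mulLeft A))
    (G := (AddMonoidHom.mulRight A.adj).comp adjHom) N
    (fun B M hB => (add_comm N M ▸ (hN.mul hB).adj :))
    (fun B M hB => hB.adj.mul hN.adj) (fun b j => ?_) B
  change (A * mono b j).adj = (mono b j).adj * A.adj
  rw [mono_eq b j, ← mul_assoc, adj_mul_D, adj_mul_D, adj_mul_mono_zero, adj_mono_zero,
    smul_mul_assoc, mul_assoc]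

theorem adj_one : (1 : PDO K).adj = 1 := by
  rw [← D_zero, ← mono_one, adj_mono_zero]

theorem adj_D (i : ℤ) : (D i : PDO K).adj = (i.negOnePow : ℤ) • D i := by
  rw [← mono_one, adj_mono, ← mono_one, mono_eq 1 i, mono_one 0, D_zero, mul_one]

theorem adj_adj (A : PDO K) : A.adj.adj = A := by
  refine addHom_ext (F := adjHom.comp adjHom) (G := AddMonoidHom.id _) 0
    (fun A N hA => (add_zero N).symm ▸ hA.adj.adj) (fun A N hA => by simpa using hA) (fun a i => ?_) A
  change (mono a i).adj.adj = mono a i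
  rw [adj_mono, adj_zsmul, adj_mul, adj_mono_zero, adj_D, mul_smul_comm, smul_smul, ← mono_eq]
  simp

theorem adj_pow (A : PDO K) (n : ℕ) : (A ^ n).adj = A.adj ^ n := by
  induction n with
  | zero => exact adj_one
  | succ n ih => rw [pow_succ, adj_mul, ih, pow_succ']

/-- Only k = 0 survives: for k ≥ 1 the binomial is (k−1 choose k) = 0. -/
theorem coeff_adj_neg_one (A : PDO K) : A.adj.coeff (-1) = -A.coeff (-1) := by
  rw [coeff_adj, finsum_eq_single _ 0]
  · simp
  · intro k hk
    obtain ⟨k, rfl⟩ := Nat.exists_eq_succ_of_ne_zero hk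
    rw [show (-1 : ℤ) + (k + 1 : ℕ) = (k : ℕ) by push_cast; ring, Ring.choose_natCast,
      Nat.choose_succ_self]
    simp

/-! ### The flows as derivations commuting with the adjoint. -/

section Flow

theorem coeff_flow (n : ℕ+) (A : PDO K) (k : ℤ) : (A.flow n).coeff k = dt n (A.coeff k) := rfl

/-- The coefficientwise derivative as an additive map. -/
def flowHom (n : ℕ+) : PDO K →+ PDO K := AddMonoidHom.mk' (flow n) fun A B => by
  ext1; funext k
  exact map_add (MvPowerSeries.pderiv K n) _ _

theorem OrdLE.flow {A : PDO K} {N : ℤ} (hA : A.OrdLE N) (n : ℕ+) : (A.flow n).OrdLE N :=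
  fun k hk => by rw [coeff_flow, hA k hk]; exact map_zero (MvPowerSeries.pderiv K n)

theorem flow_mono (n : ℕ+) (a : Fn K) (i : ℤ) : (mono a i).flow n = mono (dt n a) i := by
  ext1; funext k
  rw [coeff_flow, coeff_mono, coeff_mono]
  split_ifs <;> simp [dt]

theorem flow_D (n : ℕ+) (i : ℤ) : (D i : PDO K).flow n = 0 := by
  rw [← mono_one, flow_mono]
  ext1; funext k
  simp [coeff_mono, dt]

theorem flow_mono_mul_mono (n : ℕ+) (a b : Fn K) (i j : ℤ) :
    (mono a i * mono b j).flow n = (mono a i).flow n * mono b j + mono a i * (mono b j).flow n := by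
  have h := fun a b : Fn K => (ordLE_mono a i).mul (ordLE_mono b j)
  rw [flow_mono, flow_mono]
  refine ext_of_ordLE ((h a b).flow n) ((h _ b).add (h a _)) fun s => ?_
  rw [coeff_flow, coeff_add, coeff_mono_mul_mono, coeff_mono_mul_mono, coeff_mono_mul_mono,
    ← smul_add, ← dt_dxHom]
  simp only [dt, map_zsmul, Derivation.leibniz, smul_eq_mul]
  rw [add_comm, mul_comm (dxHom s b)]

theorem flow_mul (n : ℕ+) (A B : PDO K) : (A * B).flow n = A.flow n * B + A * B.flow n := by
  obtain ⟨M, hM⟩ := B.exists_ordLE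
  refine addHom_ext (F := (flowHom n).comp (AddMonoidHom.mulRight B))
    (G := (AddMonoidHom.mulRight B).comp (flowHom n) + AddMonoidHom.mulRight (B.flow n)) M
    (fun A N hA => (hA.mul hM).flow n)
    (fun A N hA => ((hA.flow n).mul hM).add (hA.mul (hM.flow n))) (fun a i => ?_) A
  refine addHom_ext (F := (flowHom n).comp (AddMonoidHom.mulLeft (mono a i)))
    (G := AddMonoidHom.mulLeft ((mono a i).flow n) +
      (AddMonoidHom.mulLeft (mono a i)).comp (flowHom n)) i
    (fun B N hB => (add_comm i N ▸ ((ordLE_mono a i).mul hB).flow n :))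
    (fun B N hB => (add_comm i N ▸ (((ordLE_mono a i).flow n).mul hB).add
      ((ordLE_mono a i).mul (hB.flow n)) :)) (fun b j => ?_) B
  exact flow_mono_mul_mono n a b i j

theorem flow_adj (n : ℕ+) (A : PDO K) : A.adj.flow n = (A.flow n).adj := by
  refine addHom_ext (F := (flowHom n).comp adjHom) (G := adjHom.comp (flowHom n)) 0
    (fun A N hA => (add_zero N).symm ▸ hA.adj.flow n)
    (fun A N hA => (add_zero N).symm ▸ (hA.flow n).adj)
    (fun a i => ?_) A
  change (mono a i).adj.flow n = ((mono a i).flow n).adj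
  rw [flow_mono, adj_mono, adj_mono, ← flow_mono]
  change flowHom n (_ • _) = _
  rw [map_zsmul]
  change _ • (D i * mono a 0).flow n = _
  rw [flow_mul, flow_D, zero_mul, zero_add]

end Flow

/-! ### Inverses of monic operators of order zero. -/

section Inverse

theorem one_sub_ordLE {A : PDO K} (h0 : A.coeff 0 = 1) (hA : A.OrdLE 0) : (1 - A).OrdLE (-1) := by
  intro n hn
  rcases (show n = 0 ∨ 0 < n by omega) with rfl | h
  · rw [coeff_sub, h0, ← D_zero, ← mono_one, coeff_mono_self, sub_self]
  · exact (ordLE_one.sub hA) n h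

/-- Since (1 − A)^k has order at most −k, dropping the terms with k ≥ M changes only orders up to
−M; the finite geometric sum identity then yields `mul_inv`. -/
theorem inv_sub_geom_ordLE {A : PDO K} (h0 : A.coeff 0 = 1) (hA : A.OrdLE 0) (M : ℕ) :
    (A.inv - ∑ k ∈ range M, (1 - A) ^ k).OrdLE (-M) := by
  intro n hn
  rw [coeff_sub, coeff_sum, sub_eq_zero]
  change ∑ k ∈ range ((-n).toNat + 1), ((1 - A) ^ k).coeff n = _
  have hpow := fun k : ℕ => (one_sub_ordLE h0 hA).pow k
  by_cases hn0 : 0 < n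
  · rw [sum_eq_zero fun k _ => hpow k n (by omega), sum_eq_zero fun k _ => hpow k n (by omega)]
  refine sum_subset (fun k hk => ?_) fun k hk hk' => ?_
  · simp only [mem_range] at hk ⊢; omega
  · simp only [mem_range] at hk hk'
    exact hpow k n (by omega)

theorem inv_ordLE {A : PDO K} (h0 : A.coeff 0 = 1) (hA : A.OrdLE 0) : A.inv.OrdLE 0 := by
  simpa using inv_sub_geom_ordLE h0 hA 0

theorem coeff_zero_inv (A : PDO K) : A.inv.coeff 0 = 1 := by
  change ∑ k ∈ range ((-0 : ℤ).toNat + 1), ((1 - A) ^ k).coeff 0 = 1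
  simp only [neg_zero, Int.toNat_zero, zero_add, sum_range_one, pow_zero]
  exact coeff_mono_self 1 0

theorem mul_inv {A : PDO K} (h0 : A.coeff 0 = 1) (hA : A.OrdLE 0) : A * A.inv = 1 := by
  rw [← sub_eq_zero]
  refine eq_zero_of_ordLE fun M => ?_
  have h1 := hA.mul (inv_sub_geom_ordLE h0 hA M)
  have h2 := mul_neg_geom_sum (1 - A) M
  rw [sub_sub_cancel] at h2
  rw [mul_sub, h2, zero_add] at h1
  have h3 := (one_sub_ordLE h0 hA).pow M
  rw [mul_neg_one] at h3
  have h4 := h1.sub h3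
  rwa [sub_sub, sub_add_cancel] at h4

/-- The right inverse is again monic of order zero, so it has a right inverse itself, which must be
A. -/
theorem inv_mul {A : PDO K} (h0 : A.coeff 0 = 1) (hA : A.OrdLE 0) : A.inv * A = 1 := by
  have hi := mul_inv (coeff_zero_inv A) (inv_ordLE h0 hA)
  have : A = A.inv.inv := by
    calc A = A * (A.inv * A.inv.inv) := by rw [hi, mul_one]
      _ = A.inv.inv := by rw [← mul_assoc, mul_inv h0 hA, one_mul]
  exact (congrArg (A.inv * ·) this).trans hi

end Inverse

/-! ### Differential operators, their action on functions, and residues. -/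

section Differential

/-- The operator contains no negative powers of `D`. -/
def IsDiff (A : PDO K) : Prop := ∀ n < 0, A.coeff n = 0

theorem isDiff_plus (A : PDO K) : A.plus.IsDiff := fun n hn => if_neg (by omega)

theorem isDiff_one : (1 : PDO K).IsDiff := fun n hn => if_neg (by omega)

theorem isDiff_mono_zero (a : Fn K) : (mono a 0).IsDiff := fun n hn => if_neg (by omega)

theorem IsDiff.add {A B : PDO K} (hA : A.IsDiff) (hB : B.IsDiff) : (A + B).IsDiff :=
  fun n hn => by rw [coeff_add, hA n hn, hB n hn, add_zero]

theorem IsDiff.sub {A B : PDO K} (hA : A.IsDiff) (hB : B.IsDiff) : (A - B).IsDiff :=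
  fun n hn => by rw [coeff_sub, hA n hn, hB n hn, sub_zero]

theorem IsDiff.neg {A : PDO K} (hA : A.IsDiff) : (-A).IsDiff :=
  fun n hn => by rw [coeff_neg, hA n hn, neg_zero]

theorem IsDiff.zsmul {A : PDO K} (hA : A.IsDiff) (c : ℤ) : (c • A).IsDiff :=
  fun n hn => by rw [coeff_smul, hA n hn, smul_zero]

theorem IsDiff.sum {ι : Type*} {s : Finset ι} {A : ι → PDO K} (h : ∀ i ∈ s, (A i).IsDiff) :
    (∑ i ∈ s, A i).IsDiff :=
  fun n hn => by rw [coeff_sum]; exact sum_eq_zero fun i hi => h i hi n hn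

theorem IsDiff.flow {A : PDO K} (hA : A.IsDiff) (n : ℕ+) : (A.flow n).IsDiff :=
  fun k hk => by rw [coeff_flow, hA k hk]; exact map_zero (MvPowerSeries.pderiv K n)

/-- A product with a differential operator on the left has no coefficient below the lowest power
in the right factor. -/
theorem IsDiff.coeff_mul_eq_zero {A B : PDO K} (hA : A.IsDiff) {m n : ℤ}
    (hB : ∀ k < m, B.coeff k = 0) (hn : n < m) : (A * B).coeff n = 0 := by
  rw [coeff_mul, ← finsum_zero (α := ℤ × ℕ)]
  refine finsum_congr fun p => ?_
  by_cases h : p.1 < 0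
  · rw [hA _ h, zero_mul, smul_zero]
  · by_cases h' : n - p.1 + p.2 < m
    · rw [hB _ h', map_zero, mul_zero, smul_zero]
    -- Here the power i of D is nonnegative and more than i derivatives are taken, so the binomial
    -- coefficient vanishes.
    · obtain ⟨i, hi⟩ := Int.eq_ofNat_of_zero_le (not_lt.mp h)
      rw [hi, Ring.choose_natCast, Nat.choose_eq_zero_of_lt (by omega)]
      simp

theorem IsDiff.mul {A B : PDO K} (hA : A.IsDiff) (hB : B.IsDiff) : (A * B).IsDiff :=
  fun _ hn => hA.coeff_mul_eq_zero hB hn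

theorem IsDiff.adj {A : PDO K} (hA : A.IsDiff) : A.adj.IsDiff := fun n hn => by
  rw [coeff_adj, ← finsum_zero (α := ℕ)]
  refine finsum_congr fun k => ?_
  by_cases h : n + k < 0
  · rw [hA _ h, map_zero, smul_zero]
  · obtain ⟨i, hi⟩ := Int.eq_ofNat_of_zero_le (not_lt.mp h)
    rw [hi, Ring.choose_natCast, Nat.choose_eq_zero_of_lt (by omega)]
    simp

theorem plus_eq_self {A : PDO K} (hA : A.IsDiff) : A.plus = A := by
  ext1; funext n
  change (if 0 ≤ n then A.coeff n else 0) = A.coeff n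
  split_ifs with h
  · rfl
  · exact (hA n (by omega)).symm

theorem sub_plus_ordLE (A : PDO K) : (A - A.plus).OrdLE (-1) := fun n hn => by
  change A.coeff n - (if 0 ≤ n then A.coeff n else 0) = 0
  rw [if_pos (by omega), sub_self]

theorem plus_eq_of_sub_ordLE {A B : PDO K} (h : (A - B).OrdLE (-1)) : A.plus = B.plus := by
  ext1; funext n
  change (if 0 ≤ n then A.coeff n else 0) = if 0 ≤ n then B.coeff n else 0
  split_ifs with hn
  · exact sub_eq_zero.mp (h n (by omega))
  · rfl

theorem adj_plus (A : PDO K) : A.plus.adj = A.adj.plus := by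
  have h := (sub_plus_ordLE A).adj
  rw [adj_sub] at h
  rw [plus_eq_of_sub_ordLE h, plus_eq_self (isDiff_plus A).adj]

/-- Turns the action into a coefficient of the composition with multiplication by f, so that the
ring laws apply to it. -/
theorem plusApply_eq (A : PDO K) (f : Fn K) : A.plusApply f = (A * mono f 0).coeff 0 := by
  have hfin : ∀ A : PDO K, (Function.support fun j : ℕ => A.coeff j * dx^[j] f).Finite := by
    intro A
    obtain ⟨N, hN⟩ := A.exists_ordLE
    refine (Set.finite_Iic N.toNat).subset fun j hj => ?_
    by_contra hlt
    exact hj (by simp [hN j (by simp only [Set.mem_Iic] at hlt; omega)])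
  rw [← sub_eq_zero]
  refine addHom_eq_zero (AddMonoidHom.mk' (fun A => A.plusApply f - (A * mono f 0).coeff 0)
    fun A B => ?_) ⟨-1, fun A hA => ?_⟩ (fun a i => ?_) A
  · have : (A + B).plusApply f = A.plusApply f + B.plusApply f := by
      refine Eq.trans ?_ (finsum_add_distrib (hfin A) (hfin B))
      exact finsum_congr fun j => add_mul _ _ _
    rw [this, add_mul, coeff_add]
    abel
  · change ∑ᶠ j : ℕ, A.coeff j * dx^[j] f - _ = 0
    rw [(hA.mul (ordLE_mono f 0)) 0 (by omega), sub_zero, ← finsum_zero (α := ℕ)]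
    exact finsum_congr fun j => by rw [hA j (by omega), zero_mul]
  · change ∑ᶠ j : ℕ, (mono a i).coeff j * dx^[j] f - (mono a i * mono f 0).coeff 0 = 0
    rw [sub_eq_zero]
    by_cases h : i < 0
    · rw [((ordLE_mono a i).mul (ordLE_mono f 0)) 0 (by omega), ← finsum_zero (α := ℕ)]
      exact finsum_congr fun j => by rw [coeff_mono, if_neg (by omega), zero_mul]
    · obtain ⟨i, rfl⟩ := Int.eq_ofNat_of_zero_le (not_lt.mp h)
      have := coeff_mono_mul_mono a f i 0 i
      rw [add_zero, sub_self, Ring.choose_natCast, Nat.choose_self, Nat.cast_one, one_smul] at this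
      rw [this, finsum_eq_single _ i fun j hj => by
        rw [coeff_mono, if_neg (by exact_mod_cast hj), zero_mul], coeff_mono_self]
      rfl

/-- The action of the differential part as an additive map in the operator. -/
def plusApplyHom (f : Fn K) : PDO K →+ Fn K :=
  AddMonoidHom.mk' (fun A => A.plusApply f) fun A B => by
    simp only [plusApply_eq, add_mul, coeff_add]

theorem plusApply_of_ordLE {A : PDO K} (hA : A.OrdLE (-1)) (f : Fn K) : A.plusApply f = 0 := by
  rw [plusApply_eq]
  exact (hA.mul (ordLE_mono f 0)) 0 (by omega)

theorem plusApply_plus (A : PDO K) (f : Fn K) : A.plus.plusApply f = A.plusApply f := by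
  have := plusApply_of_ordLE (sub_plus_ordLE A) f
  exact (sub_eq_zero.mp ((map_sub (plusApplyHom f) A A.plus).symm.trans this)).symm

theorem plusApply_mono_zero_mul (a : Fn K) (A : PDO K) (f : Fn K) :
    (mono a 0 * A).plusApply f = a * A.plusApply f := by
  rw [plusApply_eq, mul_assoc, coeff_mono_zero_mul, plusApply_eq]

theorem one_plusApply (f : Fn K) : (1 : PDO K).plusApply f = f := by
  rw [plusApply_eq, one_mul, coeff_mono_self]

/-- For differential B, the operator B ∘ f − B(f) contains only positive powers of D, and a
differential left factor cannot bring them down to D⁰. -/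
theorem plusApply_mul {A B : PDO K} (hA : A.IsDiff) (hB : B.IsDiff) (f : Fn K) :
    (A * B).plusApply f = A.plusApply (B.plusApply f) := by
  simp only [plusApply_eq, mul_assoc]
  rw [← sub_eq_zero, ← coeff_sub, ← mul_sub]
  refine hA.coeff_mul_eq_zero (m := 1) (fun k hk => ?_) one_pos
  rcases (show k = 0 ∨ k < 0 by omega) with rfl | h
  · rw [coeff_sub, coeff_mono_self, sub_self]
  · exact ((hB.mul (isDiff_mono_zero f)).sub (isDiff_mono_zero _)) k h

theorem dt_plusApply (n : ℕ+) (A : PDO K) (f : Fn K) :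
    dt n (A.plusApply f) = (A.flow n).plusApply f + A.plusApply (dt n f) := by
  simp only [plusApply_eq, ← flow_mono, ← coeff_flow, flow_mul, coeff_add]

theorem mul_coeff_support_finite {A : PDO K} {F : ℤ → Fn K} {m : ℤ} (hF : ∀ n < m, F n = 0) :
    (Function.support fun j => A.coeff j * F j).Finite := by
  obtain ⟨N, hN⟩ := A.exists_ordLE
  refine (Set.finite_Icc m N).subset fun j hj => ⟨?_, ?_⟩
  · by_contra hlt; exact hj (by simp [hF j (by omega)])
  · by_contra hlt; exact hj (by simp [hN j (by omega)])

/-- An additive map that is linear over functions and ignores terms of low order is given by its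
values on the powers of `D`. -/
theorem addHom_eq_finsum (F : PDO K →+ Fn K) {m : ℤ} (hF : ∀ A : PDO K, A.OrdLE (m - 1) → F A = 0)
    (hl : ∀ a A, F (mono a 0 * A) = a * F A) (A : PDO K) :
    F A = ∑ᶠ j : ℤ, A.coeff j * F (D j) := by
  have h0 : ∀ n < m, F (D n) = 0 := fun n hn => hF _ ((ordLE_D n).mono (by omega))
  rw [← sub_eq_zero]
  refine addHom_eq_zero (AddMonoidHom.mk' (fun A => F A - ∑ᶠ j : ℤ, A.coeff j * F (D j))
    fun A B => ?_) ⟨m - 1, fun A hA => ?_⟩ (fun a i => ?_) A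
  · have := finsum_add_distrib (mul_coeff_support_finite (A := A) h0)
      (mul_coeff_support_finite (A := B) h0)
    simp only [coeff_add, add_mul, this, map_add]
    abel
  · change F A - _ = 0
    rw [hF A hA, zero_sub, neg_eq_zero, ← finsum_zero (α := ℤ)]
    refine finsum_congr fun j => ?_
    by_cases h : j < m
    · rw [h0 j h, mul_zero]
    · rw [hA j (by omega), zero_mul]
  · change F _ - _ = 0
    rw [mono_eq, hl, finsum_eq_single _ i fun j hj => by
      rw [← mono_eq, coeff_mono, if_neg hj, zero_mul], ← mono_eq, coeff_mono_self, sub_self]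

/-- The classical equality of residues: res_D (A B*) is the residue in λ of A(e^ξ) B(e^(−ξ)), that
is, of the symbols A(λ) B(−λ). -/
theorem coeff_neg_one_mul_adj (A B : PDO K) : (A * B.adj).coeff (-1) =
    ∑ᶠ j : ℤ, A.coeff j * (((j + 1).negOnePow : ℤ) • B.coeff (-1 - j)) := by
  obtain ⟨M, hM⟩ := B.exists_ordLE
  refine (addHom_eq_finsum ((coeffHom (-1)).comp (AddMonoidHom.mulRight B.adj)) (m := -1 - M)
    (fun A hA => (hA.mul hM.adj) (-1) (by omega)) (fun a A => ?_) A).trans ?_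
  · change (mono a 0 * A * B.adj).coeff (-1) = a * (A * B.adj).coeff (-1)
    rw [mul_assoc, coeff_mono_zero_mul]
  · refine finsum_congr fun j => ?_
    change _ * (D j * B.adj).coeff (-1) = _
    have h := adj_mul_D B j
    have h' : D j * B.adj = (j.negOnePow : ℤ) • (B * D j).adj := by
      rw [h, smul_smul]; simp
    rw [h', coeff_smul, coeff_adj_neg_one, coeff_mul_D, Int.negOnePow_succ]
    simp

theorem plusApply_mul_eq_finsum (A : PDO K) {B : PDO K} (hB : B.OrdLE 0) (f : Fn K) :
    (A * B).plusApply f = ∑ᶠ j : ℤ, A.coeff j * (D j * B).plusApply f := by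
  refine addHom_eq_finsum ((plusApplyHom f).comp (AddMonoidHom.mulRight B)) (m := 0)
    (fun A hA => plusApply_of_ordLE (by simpa using hA.mul hB) f) (fun a A => ?_) A
  change (mono a 0 * A * B).plusApply f = a * (A * B).plusApply f
  rw [mul_assoc, plusApply_mono_zero_mul]

end Differential

end PDO

/-! ### Two-sided series in λ as Laurent series in λ⁻¹; finitary maps. -/

section Tame

variable {σ τ K : Type*} [CommRing K]

/-- The weight `∑ i, w i * m i` of a monomial. -/
def wt (w : σ → ℕ) : (σ →₀ ℕ) →+ ℕ := Finsupp.liftAddHom fun i => AddMonoidHom.mulLeft (w i)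

theorem wt_apply (w : σ → ℕ) (m : σ →₀ ℕ) : wt w m = m.sum fun i e => w i * e := rfl

theorem wt_single (w : σ → ℕ) (i : σ) (e : ℕ) : wt w (Finsupp.single i e) = w i * e := by
  simp [wt]

/-- A family of coefficients of powers of `λ` such that a monomial of weight `d` occurs only up to
`λ ^ (c + d)`. -/
def Tame (w : σ → ℕ) (F : ℤ → MvPowerSeries σ K) : Prop :=
  ∃ c : ℤ, ∀ (k : ℤ) (m : σ →₀ ℕ), c + wt w m < k → MvPowerSeries.coeff m (F k) = 0

variable {w : σ → ℕ}

theorem Tame.of_bdd {F : ℤ → MvPowerSeries σ K} (h : ∃ N : ℤ, ∀ k, N < k → F k = 0) :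
    Tame w F := by
  obtain ⟨N, hN⟩ := h
  exact ⟨N, fun k m hk => by rw [hN k (by omega), map_zero]⟩

theorem Tame.pderiv {F : ℤ → MvPowerSeries σ K} (h : Tame w F) (i : σ) :
    Tame w fun k => MvPowerSeries.pderiv K i (F k) := by
  obtain ⟨c, hc⟩ := h
  refine ⟨c + w i, fun k m hk => ?_⟩
  rw [MvPowerSeries.coeff_pderiv, hc k _ ?_, zero_mul]
  rw [map_add, wt_single]
  push_cast
  omega

theorem Tame.comp_add {F : ℤ → MvPowerSeries σ K} (h : Tame w F) (n : ℤ) :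
    Tame w fun k => F (k + n) := by
  obtain ⟨c, hc⟩ := h
  exact ⟨c - n, fun k m hk => hc _ m (by omega)⟩

theorem Tame.zsmul {F : ℤ → MvPowerSeries σ K} (h : Tame w F) (s : ℤ → ℤ) :
    Tame w fun k => s k • F k := by
  obtain ⟨c, hc⟩ := h
  exact ⟨c, fun k m hk => by rw [map_zsmul, hc k m hk, smul_zero]⟩

theorem Tame.mulDefined {F G : ℤ → MvPowerSeries σ K} (hF : Tame w F) (hG : Tame w G) :
    MulDefined F G := by
  classical
  obtain ⟨c, hc⟩ := hF
  obtain ⟨d, hd⟩ := hG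
  intro k m
  refine (Set.finite_Icc (k - d - wt w m) (c + wt w m)).subset fun i hi => ?_
  by_contra hcon
  refine hi ?_
  change MvPowerSeries.coeff m (F i * G (k - i)) = 0
  rw [MvPowerSeries.coeff_mul]
  refine sum_eq_zero fun p hp => ?_
  have hp : wt w p.1 + wt w p.2 = wt w m := by
    rw [← map_add, HasAntidiagonal.mem_antidiagonal.mp hp]
  simp only [Set.mem_Icc, not_and_or, not_le] at hcon
  rcases hcon with h | h
  · rw [hd _ p.2 (by omega), mul_zero]
  · rw [hc _ p.1 (by omega), zero_mul]

theorem coeff_lmul (F G : ℤ → MvPowerSeries σ K) (k : ℤ) (m : σ →₀ ℕ) :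
    MvPowerSeries.coeff m (lmul F G k) =
      ∑ᶠ i : ℤ, MvPowerSeries.coeff m (F i * G (k - i)) := rfl

/-- The two-sided series in `λ` obtained from a Laurent series in `λ⁻¹` by replacing every variable
`i` by its multiple by `λ ^ w i`. -/
def fromHahn (w : σ → ℕ) (H : HahnSeries ℤ (MvPowerSeries σ K)) : ℤ → MvPowerSeries σ K :=
  fun k m => MvPowerSeries.coeff m (H.coeff (wt w m - k))

theorem coeff_fromHahn (H : HahnSeries ℤ (MvPowerSeries σ K)) (k : ℤ) (m : σ →₀ ℕ) :
    MvPowerSeries.coeff m (fromHahn w H k) = MvPowerSeries.coeff m (H.coeff (wt w m - k)) := rfl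

theorem fromHahn_injective : Function.Injective (fromHahn (K := K) w) := by
  intro H H' h
  ext n m
  have := congrArg (MvPowerSeries.coeff m) (congrFun h (wt w m - n))
  rwa [coeff_fromHahn, coeff_fromHahn, sub_sub_cancel] at this

theorem tame_fromHahn (H : HahnSeries ℤ (MvPowerSeries σ K)) : Tame w (fromHahn w H) :=
  ⟨-H.order, fun k m hk => by
    rw [coeff_fromHahn, HahnSeries.coeff_eq_zero_of_lt_order (by omega), map_zero]⟩

theorem Tame.exists_fromHahn {F : ℤ → MvPowerSeries σ K} (h : Tame w F) :
    ∃ H, fromHahn w H = F := by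
  obtain ⟨c, hc⟩ := h
  let f : ℤ → MvPowerSeries σ K := fun n m => MvPowerSeries.coeff m (F (wt w m - n))
  have hf : BddBelow (Function.support f) := by
    refine ⟨-c, fun n hn => ?_⟩
    by_contra hlt
    refine hn ?_
    ext m
    exact hc _ m (by omega)
  refine ⟨HahnSeries.ofSuppBddBelow f hf, ?_⟩
  funext k
  ext m
  change MvPowerSeries.coeff m (F (wt w m - (wt w m - k))) = _
  rw [sub_sub_cancel]

theorem hahn_coeff_mul (H G : HahnSeries ℤ (MvPowerSeries σ K)) (n : ℤ) :
    (H * G).coeff n = ∑ᶠ p : ℤ, H.coeff p * G.coeff (n - p) := by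
  have hinj : Set.InjOn (fun p : ℤ × ℤ => p.1)
      (Finset.antidiagonal H.isPWO_support G.isPWO_support n : Set (ℤ × ℤ)) := by
    rintro ⟨a, b⟩ h1 ⟨a', b'⟩ h2 h
    simp only [mem_coe, Finset.mem_antidiagonal, Prod.mk.injEq] at h1 h2 h ⊢
    omega
  rw [HahnSeries.coeff_mul, finsum_eq_finsetSum_of_support_subset
    (s := (Finset.antidiagonal H.isPWO_support G.isPWO_support n).image fun p => p.1), sum_image hinj]
  · refine sum_congr rfl fun p hp => ?_
    have := (Finset.mem_antidiagonal.mp hp).2.2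
    rw [show n - p.1 = p.2 by omega]
  · intro p hp
    simp only [coe_image, Set.mem_image, mem_coe, Finset.mem_antidiagonal, Prod.exists,
      HahnSeries.mem_support]
    exact ⟨p, n - p, ⟨left_ne_zero_of_mul hp, right_ne_zero_of_mul hp, by omega⟩, rfl⟩

theorem hahn_mul_support_finite (H G : HahnSeries ℤ (MvPowerSeries σ K)) (n : ℤ) :
    (Function.support fun p : ℤ => H.coeff p * G.coeff (n - p)).Finite := by
  refine (Set.finite_Icc H.order (n - G.order)).subset fun p hp => ?_
  by_contra hcon
  refine hp ?_
  simp only [Set.mem_Icc, not_and_or, not_le] at hcon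
  rcases hcon with h | h
  · simp only [HahnSeries.coeff_eq_zero_of_lt_order h, zero_mul]
  · simp only [HahnSeries.coeff_eq_zero_of_lt_order (x := G) (i := n - p) (by omega), mul_zero]

/-- Weights add under multiplication of monomials, so rescaling each variable by its power of λ
respects products. Associativity and commutativity for tame series are thereby borrowed from Hahn
series. -/
theorem lmul_fromHahn (H G : HahnSeries ℤ (MvPowerSeries σ K)) :
    lmul (fromHahn w H) (fromHahn w G) = fromHahn w (H * G) := by
  classical
  funext k
  ext m
  rw [coeff_lmul, coeff_fromHahn, hahn_coeff_mul]
  have h1 := AddMonoidHom.map_finsum (MvPowerSeries.coeff (R := K) m).toAddMonoidHom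
    (hahn_mul_support_finite H G (wt w m - k))
  refine Eq.trans ?_ h1.symm
  simp only [LinearMap.toAddMonoidHom_coe, MvPowerSeries.coeff_mul, coeff_fromHahn]
  have hfin : ∀ p : (σ →₀ ℕ) × (σ →₀ ℕ), (Function.support fun i : ℤ =>
      MvPowerSeries.coeff p.1 (H.coeff i) *
        MvPowerSeries.coeff p.2 (G.coeff (wt w m - k - i))).Finite := by
    intro p
    refine (Set.finite_Icc H.order (wt w m - k - G.order)).subset fun i hi => ?_
    by_contra hcon
    refine hi ?_
    simp only [Set.mem_Icc, not_and_or, not_le] at hcon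
    rcases hcon with h | h
    · simp only [HahnSeries.coeff_eq_zero_of_lt_order h, map_zero, zero_mul]
    · simp only [HahnSeries.coeff_eq_zero_of_lt_order (x := G) (i := wt w m - k - i) (by omega),
        map_zero, mul_zero]
  -- For a fixed splitting of the monomial m, the reflection i ↦ wt(p.1) − i turns λ-exponents into
  -- Hahn exponents.
  have hre : ∀ p ∈ antidiagonal m, (fun i : ℤ =>
      MvPowerSeries.coeff p.1 (H.coeff (wt w p.1 - i)) *
        MvPowerSeries.coeff p.2 (G.coeff (wt w p.2 - (k - i)))) =
      (fun i : ℤ => MvPowerSeries.coeff p.1 (H.coeff i) *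
        MvPowerSeries.coeff p.2 (G.coeff (wt w m - k - i))) ∘ Equiv.subLeft (wt w p.1 : ℤ) := by
    intro p hp
    funext i
    have hp : wt w p.1 + wt w p.2 = wt w m := by
      rw [← map_add, HasAntidiagonal.mem_antidiagonal.mp hp]
    simp only [Function.comp_apply, Equiv.subLeft_apply]
    congr 3
    rw [show wt w p.2 - (k - i) = (wt w m : ℤ) - k - (wt w p.1 - i) by omega]
  rw [finsum_sum_comm _ _ fun p hp => ?_, finsum_sum_comm _ _ fun p _ => hfin p]
  · refine sum_congr rfl fun p hp => ?_
    rw [hre p hp]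
    exact finsum_comp_equiv (Equiv.subLeft (wt w p.1 : ℤ)) (f := fun i : ℤ =>
      MvPowerSeries.coeff p.1 (H.coeff i) * MvPowerSeries.coeff p.2 (G.coeff (wt w m - k - i)))
  · rw [hre p hp]
    exact (hfin p).preimage (Equiv.injective _).injOn

theorem Tame.lmul {F G : ℤ → MvPowerSeries σ K} (hF : Tame w F) (hG : Tame w G) :
    Tame w (lmul F G) := by
  obtain ⟨H, rfl⟩ := hF.exists_fromHahn
  obtain ⟨H', rfl⟩ := hG.exists_fromHahn
  rw [lmul_fromHahn]
  exact tame_fromHahn _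

theorem divLambda_fromHahn (H : HahnSeries ℤ (MvPowerSeries σ K)) :
    divLambda (fromHahn w H) = fromHahn w (HahnSeries.single 1 1 * H) := by
  funext k
  ext m
  change MvPowerSeries.coeff m (H.coeff (wt w m - (k + 1))) =
    MvPowerSeries.coeff m ((HahnSeries.single 1 1 * H).coeff (wt w m - k))
  rw [HahnSeries.coeff_single_mul, one_mul, sub_sub]

theorem fromHahn_one : fromHahn (K := K) w 1 = fun k => if k = 0 then 1 else 0 := by
  classical
  funext k
  ext m
  rw [coeff_fromHahn, HahnSeries.coeff_one]
  by_cases hm : m = 0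
  · subst hm
    rw [map_zero, Nat.cast_zero, zero_sub]
    congr 1
    simp only [neg_eq_zero]
  · split_ifs <;> simp [MvPowerSeries.coeff_one, hm]

theorem Tame.divLambda {F : ℤ → MvPowerSeries σ K} (h : Tame w F) : Tame w (divLambda F) :=
  h.comp_add 1

/-- Mutually inverse factors cancel in a product of series in `λ`. -/
theorem residue_lmul_cancel {d s S E E' : ℤ → MvPowerSeries σ K} (hd : Tame w d) (hs : Tame w s)
    (hS : Tame w S) (hE : Tame w E) (hE' : Tame w E')
    (h : KP.lmul E E' = fun k => if k = 0 then 1 else 0) :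
    residue (KP.lmul (KP.divLambda (KP.lmul (KP.lmul d E) S)) (KP.lmul s E')) =
      KP.lmul s (KP.lmul d S) 0 := by
  obtain ⟨d, rfl⟩ := hd.exists_fromHahn
  obtain ⟨s, rfl⟩ := hs.exists_fromHahn
  obtain ⟨S, rfl⟩ := hS.exists_fromHahn
  obtain ⟨E, rfl⟩ := hE.exists_fromHahn
  obtain ⟨E', rfl⟩ := hE'.exists_fromHahn
  rw [lmul_fromHahn, ← fromHahn_one (w := w)] at h
  have h := fromHahn_injective h
  simp only [lmul_fromHahn, divLambda_fromHahn]
  -- All factors now lie in a commutative ring, where `single 1 1` stands for λ⁻¹, and `h` says E E'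
  -- = 1.
  have e : HahnSeries.single 1 1 * (d * E * S) * (s * E') =
      HahnSeries.single 1 1 * (s * (d * S)) := by
    linear_combination (HahnSeries.single 1 1 * (s * (d * S))) * h
  rw [e, ← divLambda_fromHahn]
  rfl

theorem lmul_add_left {F F' G : ℤ → MvPowerSeries σ K} (h : MulDefined F G)
    (h' : MulDefined F' G) :
    lmul (fun k => F k + F' k) G = fun k => lmul F G k + lmul F' G k := by
  funext k
  ext m
  rw [map_add, coeff_lmul, coeff_lmul, coeff_lmul, ← finsum_add_distrib (h k m) (h' k m)]
  simp only [add_mul, map_add]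

theorem lmul_comp_sub (F G : ℤ → MvPowerSeries σ K) (n : ℤ) :
    lmul F (fun k => G (k - n)) = lmul (fun k => F (k - n)) G := by
  funext k
  ext m
  rw [coeff_lmul, coeff_lmul, ← finsum_comp_equiv (Equiv.subRight n)]
  refine finsum_congr fun i => ?_
  simp only [Equiv.subRight_apply, sub_sub, sub_add_cancel]

theorem lmul_zsmul_comm (F G : ℤ → MvPowerSeries σ K) (c : ℤ) :
    lmul F (fun k => c • G k) = lmul (fun k => c • F k) G := by
  funext k
  ext m
  simp only [coeff_lmul, mul_smul_comm, smul_mul_assoc]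

/-- An additive map of power series every coefficient of whose values involves finitely many
coefficients of the argument. -/
def IsFinitary (φ : MvPowerSeries σ K →+ MvPowerSeries τ K) : Prop :=
  ∀ m, ∃ s : Finset (σ →₀ ℕ), ∀ f, (∀ a ∈ s, MvPowerSeries.coeff a f = 0) →
    MvPowerSeries.coeff m (φ f) = 0

/-- Products in λ are infinite sums taken monomial by monomial. A coefficient of φ sees finitely
many monomials, hence finitely many λ-indices, so φ passes through the sum. -/
theorem IsFinitary.coeff_lmul {φ : MvPowerSeries σ K →+ MvPowerSeries τ K} (hφ : IsFinitary φ)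
    {F G : ℤ → MvPowerSeries σ K} (h : MulDefined F G) (k : ℤ) (m : τ →₀ ℕ) :
    (Function.support fun i : ℤ => MvPowerSeries.coeff m (φ (F i * G (k - i)))).Finite ∧
    MvPowerSeries.coeff m (φ (lmul F G k)) =
      ∑ᶠ i : ℤ, MvPowerSeries.coeff m (φ (F i * G (k - i))) := by
  classical
  obtain ⟨s, hs⟩ := hφ m
  let T : Finset ℤ := s.biUnion fun a => (h k a).toFinset
  have hT : ∀ a ∈ s, ∀ i ∉ T, MvPowerSeries.coeff a (F i * G (k - i)) = 0 := by
    intro a ha i hi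
    by_contra hne
    exact hi (mem_biUnion.mpr ⟨a, ha, (h k a).mem_toFinset.mpr hne⟩)
  have hsupp : (Function.support fun i : ℤ => MvPowerSeries.coeff m (φ (F i * G (k - i)))) ⊆ T := by
    intro i hi
    by_contra hiT
    exact hi (hs _ fun a ha => hT a ha i hiT)
  refine ⟨T.finite_toSet.subset hsupp, ?_⟩
  rw [finsum_eq_finsetSum_of_support_subset _ hsupp]
  have h0 := hs (lmul F G k - ∑ i ∈ T, F i * G (k - i)) fun a ha => by
    rw [map_sub, KP.coeff_lmul, finsum_eq_finsetSum_of_support_subset (s := T), map_sum, sub_self]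
    intro i hi
    by_contra hiT
    exact hi (hT a ha i hiT)
  rwa [map_sub, map_sub, map_sum, map_sum, sub_eq_zero] at h0

theorem IsFinitary.map_lmul {φ : MvPowerSeries σ K →+* MvPowerSeries τ K}
    (hφ : IsFinitary φ.toAddMonoidHom) {F G : ℤ → MvPowerSeries σ K} (h : MulDefined F G) (k : ℤ) :
    φ (lmul F G k) = lmul (fun i => φ (F i)) (fun i => φ (G i)) k := by
  ext m
  refine (hφ.coeff_lmul h k m).2.trans (finsum_congr fun i => ?_)
  exact congrArg _ (map_mul φ _ _)

theorem isFinitary_pderiv (i : σ) :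
    IsFinitary (MvPowerSeries.pderiv K i).toLinearMap.toAddMonoidHom := fun m =>
  ⟨{m + Finsupp.single i 1}, fun f hf => by
    change MvPowerSeries.coeff m (MvPowerSeries.pderiv K i f) = 0
    rw [MvPowerSeries.coeff_pderiv, hf _ (mem_singleton_self _), zero_mul]⟩

theorem isFinitary_rename (f : σ → τ) [Filter.TendstoCofinite f] :
    IsFinitary (MvPowerSeries.rename (R := K) f).toRingHom.toAddMonoidHom := fun m =>
  ⟨_, fun p hp => (MvPowerSeries.coeff_rename f p m).trans (sum_eq_zero hp)⟩

theorem isFinitary_killCompl (e : τ ↪ σ) :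
    IsFinitary (MvPowerSeries.killCompl (R := K) e).toRingHom.toAddMonoidHom := fun m =>
  ⟨{Finsupp.embDomain e m}, fun p hp =>
    (MvPowerSeries.coeff_killCompl p m).trans (hp _ (mem_singleton_self _))⟩

theorem pderiv_lmul {F G : ℤ → MvPowerSeries σ K} (hF : Tame w F) (hG : Tame w G) (i : σ) (k : ℤ) :
    MvPowerSeries.pderiv K i (lmul F G k) =
      lmul (fun j => MvPowerSeries.pderiv K i (F j)) G k +
        lmul F (fun j => MvPowerSeries.pderiv K i (G j)) k := by
  ext m
  refine ((isFinitary_pderiv i).coeff_lmul (hF.mulDefined hG) k m).2.trans ?_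
  rw [map_add, coeff_lmul, coeff_lmul,
    ← finsum_add_distrib ((hF.pderiv i).mulDefined hG k m) (hF.mulDefined (hG.pderiv i) k m)]
  refine finsum_congr fun j => ?_
  change MvPowerSeries.coeff m (MvPowerSeries.pderiv K i (F j * G (k - j))) = _
  rw [Derivation.leibniz, smul_eq_mul, smul_eq_mul, map_add, add_comm, mul_comm (G _)]

theorem Tame.rename {v : τ → ℕ} {F : ℤ → MvPowerSeries σ K} (h : Tame w F) (e : σ ↪ τ)
    (hv : ∀ i, v (e i) = w i) : Tame v fun k => MvPowerSeries.rename e (F k) := by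
  obtain ⟨c, hc⟩ := h
  refine ⟨c, fun k m hk => ?_⟩
  by_cases hm : m ∈ Set.range (Finsupp.mapDomain e)
  · obtain ⟨a, rfl⟩ := hm
    rw [← Finsupp.embDomain_eq_mapDomain, MvPowerSeries.coeff_embDomain_rename]
    refine hc k a ?_
    rwa [wt_apply, Finsupp.sum_mapDomain_index_inj e.injective, ← show wt w a = _ from
      Finsupp.sum_congr fun i _ => by rw [hv]; rfl] at hk
  · exact MvPowerSeries.coeff_rename_eq_zero _ _ hm

end Tame

/-! ### The exponential exp(εξ). -/

section ExpXi

variable {K : Type*} [CommRing K] [Algebra ℚ K]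

/-- The weights of the times. -/
abbrev timeWt : ℕ+ → ℕ := fun n => n

/-- The coefficient of a monomial in `exp (ε * ∑ n, t n)`. -/
def expCoeff (ε : ℚ) (m : ℕ+ →₀ ℕ) : ℚ := m.prod fun _ e => ε ^ e / (e.factorial : ℚ)

theorem expCoeff_add_single (ε : ℚ) (m : ℕ+ →₀ ℕ) (n : ℕ+) :
    expCoeff ε (m + Finsupp.single n 1) * (m n + 1) = ε * expCoeff ε m := by
  have h0 : ∀ i : ℕ+, (fun (_ : ℕ+) (e : ℕ) => ε ^ e / (e.factorial : ℚ)) i 0 = 1 := by simp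
  rw [expCoeff, expCoeff, ← Finsupp.mul_prod_erase' m n _ h0, ← Finsupp.mul_prod_erase' _ n _ h0]
  have : (m + Finsupp.single n 1).erase n = m.erase n := by
    rw [Finsupp.erase_add, Finsupp.erase_single, add_zero]
  rw [this, Finsupp.add_apply, Finsupp.single_eq_same, Nat.factorial_succ, pow_succ]
  push_cast
  have h1 : ((m n).factorial : ℚ) ≠ 0 := by positivity
  have h2 : ((m n : ℚ) + 1) ≠ 0 := by positivity
  field_simp

theorem coeff_expXi (ε : ℚ) (k : ℤ) (m : ℕ+ →₀ ℕ) :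
    MvPowerSeries.coeff m (expXi (K := K) ε k) =
      if (wt timeWt m : ℤ) = k then algebraMap ℚ K (expCoeff ε m) else 0 := rfl

theorem dt_expXi (ε : ℚ) (n : ℕ+) (k : ℤ) :
    dt n (expXi (K := K) ε k) = algebraMap ℚ K ε • expXi ε (k - n) := by
  ext m
  rw [dt, MvPowerSeries.coeff_pderiv, map_smul, coeff_expXi, coeff_expXi, map_add, wt_single]
  push_cast
  rw [mul_one, smul_eq_mul, show timeWt n = (n : ℕ) from rfl]
  by_cases h : (wt timeWt m : ℤ) = k - n
  · rw [if_pos (by omega), if_pos h, ← map_mul, ← expCoeff_add_single ε m n]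
    simp
  · rw [if_neg (by omega), if_neg h, zero_mul, mul_zero]

theorem tame_expXi (ε : ℚ) : Tame timeWt (expXi (K := K) ε) :=
  ⟨0, fun k m hk => by rw [coeff_expXi, if_neg (by omega)]⟩

/-- The exponential series `exp (ε * ∑ n, t n)`. -/
def expSum (K : Type*) [CommRing K] [Algebra ℚ K] (ε : ℚ) : Fn K :=
  fun m => algebraMap ℚ K (expCoeff ε m)

theorem coeff_expSum (ε : ℚ) (m : ℕ+ →₀ ℕ) :
    MvPowerSeries.coeff m (expSum K ε) = algebraMap ℚ K (expCoeff ε m) := rfl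

/-- Rescaling t_n by λⁿ turns exp(ε ∑ t_n) into exp(εξ): the exponential becomes a constant Hahn
series, and its inverse can be found without λ. -/
theorem fromHahn_expSum (ε : ℚ) :
    fromHahn timeWt (HahnSeries.C (expSum K ε)) = expXi ε := by
  funext k
  ext m
  rw [coeff_fromHahn, coeff_expXi, HahnSeries.C_apply, HahnSeries.coeff_single]
  by_cases h : (wt timeWt m : ℤ) = k
  · rw [if_pos h, if_pos (by omega), coeff_expSum]
  · rw [if_neg h, if_neg (by omega), map_zero]

theorem dt_expSum (ε : ℚ) (n : ℕ+) : dt n (expSum K ε) = algebraMap ℚ K ε • expSum K ε := by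
  ext m
  rw [dt, MvPowerSeries.coeff_pderiv, map_smul, coeff_expSum, coeff_expSum, smul_eq_mul,
    ← map_mul, ← expCoeff_add_single ε m n]
  simp

/-- All partial derivatives of the product vanish and its constant term is 1. -/
theorem expSum_mul_expSum_neg (ε : ℚ) : expSum K ε * expSum K (-ε) = 1 := by
  have : IsAddTorsionFree K := .of_module_rat K
  refine MvPowerSeries.pderiv.ext (fun i => ?_) ?_
  · have h := dt_expSum (K := K) ε i
    have h' := dt_expSum (K := K) (-ε) i
    rw [dt] at h h'
    rw [Derivation.leibniz, h, h', MvPowerSeries.pderiv_one, map_neg, smul_eq_mul, smul_eq_mul,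
      mul_smul_comm, mul_smul_comm, neg_smul, mul_comm (expSum K (-ε)), neg_add_cancel]
  · rw [map_mul, map_one, ← MvPowerSeries.coeff_zero_eq_constantCoeff_apply,
      ← MvPowerSeries.coeff_zero_eq_constantCoeff_apply, coeff_expSum, coeff_expSum]
    simp [expCoeff]

theorem lmul_expXi_expXi_neg (ε : ℚ) :
    lmul (expXi (K := K) ε) (expXi (-ε)) = fun k => if k = 0 then 1 else 0 := by
  rw [← fromHahn_expSum, ← fromHahn_expSum, lmul_fromHahn, ← map_mul, expSum_mul_expSum_neg,
    map_one, fromHahn_one]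

end ExpXi

/-! ### Closure properties of finitary maps and reduction to monomials. -/

section Finitary

variable {σ τ υ K : Type*} [CommRing K]

theorem IsFinitary.comp {ψ : MvPowerSeries τ K →+ MvPowerSeries υ K}
    {φ : MvPowerSeries σ K →+ MvPowerSeries τ K} (hψ : IsFinitary ψ) (hφ : IsFinitary φ) :
    IsFinitary (ψ.comp φ) := by
  classical
  intro m
  obtain ⟨s, hs⟩ := hψ m
  choose t ht using hφ
  exact ⟨s.biUnion t, fun f hf => hs _ fun a ha => ht a f fun b hb =>
    hf b (mem_biUnion.mpr ⟨a, ha, hb⟩)⟩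

theorem IsFinitary.add {φ ψ : MvPowerSeries σ K →+ MvPowerSeries τ K} (hφ : IsFinitary φ)
    (hψ : IsFinitary ψ) : IsFinitary (φ + ψ) := by
  classical
  intro m
  obtain ⟨s, hs⟩ := hφ m
  obtain ⟨t, ht⟩ := hψ m
  refine ⟨s ∪ t, fun f hf => ?_⟩
  rw [AddMonoidHom.add_apply, map_add, hs f fun a ha => hf a (mem_union_left t ha),
    ht f fun a ha => hf a (mem_union_right s ha), add_zero]

theorem IsFinitary.zsmul {φ : MvPowerSeries σ K →+ MvPowerSeries τ K} (hφ : IsFinitary φ)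
    (c : ℤ) : IsFinitary (c • φ) := fun m => by
  obtain ⟨s, hs⟩ := hφ m
  exact ⟨s, fun f hf => by rw [AddMonoidHom.smul_apply, map_zsmul, hs f hf, smul_zero]⟩

theorem IsFinitary.sum {ι : Type*} (s : Finset ι) {φ : ι → MvPowerSeries σ K →+ MvPowerSeries τ K}
    (hφ : ∀ i, IsFinitary (φ i)) : IsFinitary (∑ i ∈ s, φ i) :=
  sum_induction φ IsFinitary (fun _ _ => .add) (fun _ => ⟨∅, fun _ _ => map_zero _⟩)
    fun i _ => hφ i

theorem isFinitary_id : IsFinitary (AddMonoidHom.id (MvPowerSeries σ K)) :=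
  fun m => ⟨{m}, fun _ hf => hf m (mem_singleton_self m)⟩

theorem IsFinitary.eq_of_monomial {φ ψ : MvPowerSeries σ K →+ MvPowerSeries τ K}
    (hφ : IsFinitary φ) (hψ : IsFinitary ψ)
    (h : ∀ d c, φ (MvPowerSeries.monomial d c) = ψ (MvPowerSeries.monomial d c))
    (f : MvPowerSeries σ K) : φ f = ψ f := by
  classical
  ext m
  obtain ⟨s, hs⟩ := hφ.add (hψ.zsmul (-1)) m
  have h0 := hs (f - ∑ d ∈ s, MvPowerSeries.monomial d (MvPowerSeries.coeff d f)) fun a ha => by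
    simp [MvPowerSeries.coeff_monomial, ha]
  have h1 : ∀ g, (φ + (-1 : ℤ) • ψ) g = φ g - ψ g := fun g => by
    simp [sub_eq_add_neg]
  rw [h1] at h0
  simp only [map_sub, map_sum, h, sub_sub_sub_cancel_right] at h0
  exact sub_eq_zero.mp h0

end Finitary

/-! ### The coefficients of f(t + e[λ⁻¹]) and their recurrence. -/

section Shift

variable {K : Type*} [CommRing K] [Algebra ℚ K]

/-- The coefficient of `λ ^ (-n)` in `f (t + e [λ⁻¹])`, as an additive map in `f`. -/
def shiftHom (e : ℤ) (n : ℕ) : Fn K →+ Fn K := AddMonoidHom.mk' (fun f => shift e f (-n))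
  fun f g => by
    ext m
    have h : ∀ f : Fn K, MvPowerSeries.coeff m (shift e f (-n)) = if (-n : ℤ) ≤ 0 then
        MvPowerSeries.coeff (Finsupp.sumElim m (Finsupp.single () (-(-n : ℤ)).toNat))
          (MvPowerSeries.subst (shiftTimes K e) f) else 0 := fun _ => rfl
    rw [map_add, h, h, h]
    rw [MvPowerSeries.subst_add (hasSubst_shiftTimes _)]
    split_ifs <;> simp

theorem coeff_shiftHom (e : ℤ) (n : ℕ) (f : Fn K) (m : ℕ+ →₀ ℕ) :
    MvPowerSeries.coeff m (shiftHom e n f) =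
      MvPowerSeries.coeff (Finsupp.sumElim m (Finsupp.single () n))
        (MvPowerSeries.subst (shiftTimes K e) f) := by
  change (if _ then _ else _) = _
  rw [if_pos (by omega)]
  simp

theorem shift_neg (e : ℤ) (n : ℕ) (f : Fn K) : shift e f (-n) = shiftHom e n f := rfl

theorem isFinitary_shiftHom (e : ℤ) (n : ℕ) : IsFinitary (shiftHom (K := K) e n) := by
  intro m
  -- The series with all coefficients 1 detects every monomial whose image meets the given one, so
  -- the resulting finite set serves all f.
  have h := MvPowerSeries.coeff_subst_finite (hasSubst_shiftTimes (K := K) e)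
    (fun _ => 1 : MvPowerSeries ℕ+ K) (Finsupp.sumElim m (Finsupp.single () n))
  refine ⟨Set.Finite.toFinset h, fun f hf => ?_⟩
  rw [coeff_shiftHom, MvPowerSeries.coeff_subst (hasSubst_shiftTimes _),
    ← finsum_zero (α := ℕ+ →₀ ℕ)]
  refine finsum_congr fun d => ?_
  by_cases hd : d ∈ Set.Finite.toFinset h
  · rw [hf d hd, zero_smul]
  · have hd := not_not.mp fun hne => hd ((Set.Finite.mem_toFinset h).mpr hne)
    have hd : (1 : K) • MvPowerSeries.coeff (Finsupp.sumElim m (Finsupp.single () n))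
      (d.prod fun s k => shiftTimes K e s ^ k) = 0 := hd
    rw [one_smul] at hd
    rw [hd, smul_zero]

/-- The derivation `z ∂ / ∂ z - e ∑ j ≤ N, z ^ j ∂ / ∂ t j`. -/
def shiftDeriv (K : Type*) [CommRing K] (e : ℤ) (N : ℕ) :
    Derivation K (MvPowerSeries (ℕ+ ⊕ Unit) K) (MvPowerSeries (ℕ+ ⊕ Unit) K) :=
  (MvPowerSeries.X (Sum.inr ()) : MvPowerSeries (ℕ+ ⊕ Unit) K) •
      MvPowerSeries.pderiv K (Sum.inr ()) -
    ∑ j ∈ range N, (e • (MvPowerSeries.X (Sum.inr ()) : MvPowerSeries (ℕ+ ⊕ Unit) K) ^ (j + 1)) •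
      MvPowerSeries.pderiv K (Sum.inl j.succPNat)

omit [Algebra ℚ K] in
theorem shiftDeriv_apply (e : ℤ) (N : ℕ) (g : MvPowerSeries (ℕ+ ⊕ Unit) K) :
    shiftDeriv K e N g = MvPowerSeries.X (Sum.inr ()) * MvPowerSeries.pderiv K (Sum.inr ()) g -
      ∑ j ∈ range N, e • (MvPowerSeries.X (Sum.inr ()) ^ (j + 1) *
        MvPowerSeries.pderiv K (Sum.inl j.succPNat) g) := by
  simp only [shiftDeriv, Derivation.sub_apply, Derivation.smul_apply, smul_eq_mul]
  congr 1
  rw [← Derivation.coeFnAddMonoidHom_apply, map_sum, Finset.sum_apply]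
  simp only [Derivation.coeFnAddMonoidHom_apply, Derivation.smul_apply, smul_eq_mul, smul_mul_assoc]

/-- z∂_z sends e z^l / l to e z^l, which the term j = l cancels. For l > N the truncated derivation
lacks that term, but z^l is then divisible by z^(N+1). -/
theorem shiftDeriv_shiftTimes (e : ℤ) (N : ℕ) (l : ℕ+) :
    (MvPowerSeries.X (Sum.inr ()) : MvPowerSeries (ℕ+ ⊕ Unit) K) ^ (N + 1) ∣
      shiftDeriv K e N (shiftTimes K e l) := by
  have hz : MvPowerSeries.X (Sum.inr ()) * MvPowerSeries.pderiv K (Sum.inr ()) (shiftTimes K e l) =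
      e • (MvPowerSeries.X (Sum.inr ()) : MvPowerSeries (ℕ+ ⊕ Unit) K) ^ (l : ℕ) := by
    rw [shiftTimes, map_add, MvPowerSeries.pderiv_X_of_ne (by simp), zero_add, Derivation.leibniz,
      MvPowerSeries.pderiv_C, smul_zero, add_zero, MvPowerSeries.pderiv_pow,
      MvPowerSeries.pderiv_X_self, mul_one, smul_eq_mul]
    have h1 : (MvPowerSeries.X (Sum.inr ()) : MvPowerSeries (ℕ+ ⊕ Unit) K) ^ (l : ℕ) =
        MvPowerSeries.X (Sum.inr ()) * MvPowerSeries.X (Sum.inr ()) ^ ((l : ℕ) - 1) := by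
      rw [← pow_succ', Nat.sub_add_cancel l.pos]
    have h2 : MvPowerSeries.C (σ := ℕ+ ⊕ Unit) (algebraMap ℚ K (e / (l : ℕ))) * ((l : ℕ) :) =
        ((e : ℤ) :) := by
      rw [← map_natCast (MvPowerSeries.C (σ := ℕ+ ⊕ Unit) (R := K)), ← map_mul,
        ← map_natCast (algebraMap ℚ K), ← map_mul, div_mul_cancel₀ _ (by simp), map_intCast,
        map_intCast]
    rw [h1, zsmul_eq_mul, ← h2]
    ring
  have hl : ∀ j, MvPowerSeries.pderiv K (Sum.inl j) (shiftTimes K e l) = if j = l then 1 else 0 := by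
    intro j
    rw [shiftTimes, map_add, Derivation.leibniz, MvPowerSeries.pderiv_C, smul_zero, add_zero,
      MvPowerSeries.pderiv_pow, MvPowerSeries.pderiv_X_of_ne (i := Sum.inl j) (j := Sum.inr ())
        (by simp), mul_zero, smul_zero, add_zero]
    split_ifs with h
    · rw [h, MvPowerSeries.pderiv_X_self]
    · exact MvPowerSeries.pderiv_X_of_ne fun h' => h (Sum.inl_injective h').symm
  rw [shiftDeriv_apply, hz]
  simp only [hl]
  by_cases h : (l : ℕ) ≤ N
  · rw [sum_eq_single (l.natPred), if_pos (by simp), PNat.natPred_add_one, mul_one, sub_self]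
    · exact dvd_zero _
    · intro j _ hj
      rw [if_neg, mul_zero, smul_zero]
      rintro rfl
      exact hj (by simp)
    · intro hmem
      refine absurd (mem_range.mpr ?_) hmem
      have := PNat.natPred_add_one l
      omega
  · rw [sum_eq_zero, sub_zero, zsmul_eq_mul]
    · exact (pow_dvd_pow _ (by omega)).mul_left _
    · intro j hj
      rw [if_neg, mul_zero, smul_zero]
      rintro rfl
      simp only [mem_range, Nat.succPNat_coe] at hj h
      omega

/-- By the Leibniz rule the elements with divisible derivative form a submonoid, so the shifted
variables suffice. -/
theorem dvd_shiftDeriv_subst_monomial (e : ℤ) (N : ℕ) (d : ℕ+ →₀ ℕ) (c : K) :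
    (MvPowerSeries.X (Sum.inr ()) : MvPowerSeries (ℕ+ ⊕ Unit) K) ^ (N + 1) ∣
      shiftDeriv K e N (MvPowerSeries.subst (shiftTimes K e) (MvPowerSeries.monomial d c)) := by
  let S : Submonoid (MvPowerSeries (ℕ+ ⊕ Unit) K) :=
    { carrier := {g | MvPowerSeries.X (Sum.inr ()) ^ (N + 1) ∣ shiftDeriv K e N g}
      one_mem' := by simp
      mul_mem' := fun {a b} ha hb => by
        rw [Set.mem_ofPred_eq, Derivation.leibniz]
        exact dvd_add (hb.mul_left _) (ha.mul_left _) }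
  rw [MvPowerSeries.subst_monomial (hasSubst_shiftTimes _)]
  have h : d.prod (fun s k => shiftTimes K e s ^ k) ∈ S :=
    S.prod_mem fun l _ => S.pow_mem (shiftDeriv_shiftTimes e N l) _
  rw [← Algebra.smul_def, Derivation.map_smul, MvPowerSeries.smul_eq_C_mul]
  exact Dvd.dvd.mul_left h _

omit [Algebra ℚ K] in
theorem coeff_X_inr_pow_mul (m : ℕ+ →₀ ℕ) (j k : ℕ) (g : MvPowerSeries (ℕ+ ⊕ Unit) K) :
    MvPowerSeries.coeff (Finsupp.sumElim m (Finsupp.single () (j + k)))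
      (MvPowerSeries.X (Sum.inr ()) ^ j * g) =
      MvPowerSeries.coeff (Finsupp.sumElim m (Finsupp.single () k)) g := by
  have : Finsupp.sumElim m (Finsupp.single () (j + k)) =
      Finsupp.single (Sum.inr ()) j + Finsupp.sumElim m (Finsupp.single () k) := by
    ext (i | i) <;> simp
  rw [this, MvPowerSeries.X_pow_eq, MvPowerSeries.coeff_add_monomial_mul, one_mul]

theorem sumElim_add_single_inl (m : ℕ+ →₀ ℕ) (k : ℕ) (l : ℕ+) :
    Finsupp.sumElim m (Finsupp.single () k) + Finsupp.single (Sum.inl l) 1 =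
      Finsupp.sumElim (m + Finsupp.single l 1) (Finsupp.single () k) := by
  classical
  ext (i | i) <;> simp [Finsupp.single_apply]

omit [Algebra ℚ K] in
theorem coeff_pderiv_inr (m : ℕ+ →₀ ℕ) (k : ℕ) (g : MvPowerSeries (ℕ+ ⊕ Unit) K) :
    MvPowerSeries.coeff (Finsupp.sumElim m (Finsupp.single () k))
      (MvPowerSeries.pderiv K (Sum.inr ()) g) =
      MvPowerSeries.coeff (Finsupp.sumElim m (Finsupp.single () (1 + k))) g * (k + 1) := by
  classical
  have : Finsupp.sumElim m (Finsupp.single () k) + Finsupp.single (Sum.inr ()) 1 =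
      Finsupp.sumElim m (Finsupp.single () (1 + k)) := by
    ext (i | i) <;> simp [add_comm]
  rw [MvPowerSeries.coeff_pderiv, this]
  simp

/-- The coefficient of z^(n+1) in z∂_z f(t + e[z]) = e ∑_j z^j (∂_j f)(t + e[z]). Finitariness
reduces it to monomials f. -/
theorem shiftHom_succ (e : ℤ) (n : ℕ) (f : Fn K) :
    ((n + 1 : ℕ) : ℤ) • shiftHom e (n + 1) f =
      e • ∑ p ∈ antidiagonal n, dt p.1.succPNat (shiftHom e p.2 f) := by
  have h := IsFinitary.eq_of_monomial ((isFinitary_shiftHom (K := K) e (n + 1)).zsmul (n + 1 : ℕ))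
    ((IsFinitary.sum (antidiagonal n) fun p : ℕ × ℕ => (isFinitary_pderiv p.1.succPNat).comp
      (isFinitary_shiftHom (K := K) e p.2)).zsmul e) (fun d c => ?_) f
  · simp only [AddMonoidHom.smul_apply, AddMonoidHom.finsetSum_apply, AddMonoidHom.comp_apply] at h
    exact h
  · simp only [AddMonoidHom.smul_apply, AddMonoidHom.finsetSum_apply, AddMonoidHom.comp_apply]
    ext m
    -- Truncation at N = n+1 gives divisibility by z^(n+2), just enough to kill the coefficient of
    -- z^(n+1).
    have h := MvPowerSeries.X_pow_dvd_iff.mp (dvd_shiftDeriv_subst_monomial e (n + 1) d c)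
      (Finsupp.sumElim m (Finsupp.single () (n + 1))) (by simp)
    rw [shiftDeriv_apply, map_sub, sub_eq_zero] at h
    rw [← pow_one (MvPowerSeries.X (Sum.inr ())), add_comm n 1, coeff_X_inr_pow_mul,
      coeff_pderiv_inr, map_sum, add_comm 1 n] at h
    rw [map_zsmul, map_zsmul, coeff_shiftHom, map_sum,
      Finset.Nat.sum_antidiagonal_eq_sum_range_succ_mk, smul_sum, zsmul_eq_mul, mul_comm]
    push_cast
    rw [h, Nat.succ_eq_add_one]
    refine sum_congr rfl fun j hj => ?_
    have hj : n + 1 = (j + 1) + (n - j) := by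
      have := mem_range.mp hj
      omega
    rw [map_zsmul, pow_one, hj, coeff_X_inr_pow_mul, MvPowerSeries.coeff_pderiv]
    change _ = e • MvPowerSeries.coeff m (MvPowerSeries.pderiv K _ (shiftHom e (n - j) _))
    rw [MvPowerSeries.coeff_pderiv, coeff_shiftHom, sumElim_add_single_inl]
    rfl

theorem shiftHom_zero (e : ℤ) (f : Fn K) : shiftHom e 0 f = f := by
  refine IsFinitary.eq_of_monomial (isFinitary_shiftHom (K := K) e 0) isFinitary_id
    (fun d c => ?_) f
  -- Pairs that agree at z = 0 are closed under products; each shifted time is paired with the time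
  -- itself.
  let S : Submonoid (MvPowerSeries (ℕ+ ⊕ Unit) K × Fn K) :=
    { carrier := {g | MvPowerSeries.X (Sum.inr ()) ∣
        g.1 - MvPowerSeries.rename (Function.Embedding.inl : ℕ+ ↪ ℕ+ ⊕ Unit) g.2}
      one_mem' := by simp
      mul_mem' := fun {a b} ha hb => by
        obtain ⟨u, hu⟩ := ha
        obtain ⟨v, hv⟩ := hb
        refine ⟨u * b.1 + MvPowerSeries.rename (Function.Embedding.inl : ℕ+ ↪ ℕ+ ⊕ Unit) a.2 * v, ?_⟩
        rw [Prod.fst_mul, Prod.snd_mul, map_mul]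
        linear_combination b.1 * hu +
          MvPowerSeries.rename (Function.Embedding.inl : ℕ+ ↪ ℕ+ ⊕ Unit) a.2 * hv }
  have h : (d.prod (fun s k => shiftTimes K e s ^ k), d.prod fun s k => MvPowerSeries.X s ^ k) ∈ S := by
    have : d.prod (fun s k => (shiftTimes K e s, (MvPowerSeries.X s : Fn K)) ^ k) ∈ S := by
      refine S.prod_mem fun l _ => S.pow_mem ?_ _
      change (MvPowerSeries.X (Sum.inr ()) : MvPowerSeries (ℕ+ ⊕ Unit) K) ∣ shiftTimes K e l -
        MvPowerSeries.rename (Function.Embedding.inl : ℕ+ ↪ ℕ+ ⊕ Unit) (MvPowerSeries.X l)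
      rw [shiftTimes, MvPowerSeries.rename_X, Function.Embedding.inl_apply, add_sub_cancel_left]
      exact (dvd_pow_self _ l.ne_zero).mul_left _
    convert this using 1
    simp only [Finsupp.prod]
    exact Prod.ext (by rw [Prod.fst_prod]; rfl) (by rw [Prod.snd_prod]; rfl)
  ext m
  have h := MvPowerSeries.X_dvd_iff.mp h (Finsupp.sumElim m (Finsupp.single () 0)) (by simp)
  have hm : Finsupp.sumElim m (Finsupp.single () 0) =
      Finsupp.embDomain (Function.Embedding.inl : ℕ+ ↪ ℕ+ ⊕ Unit) m := by
    classical
    ext (i | i)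
    · exact (Finsupp.embDomain_apply_self _ _ i).symm
    · simp
  have hX := MvPowerSeries.subst_monomial (MvPowerSeries.HasSubst.X (S := K)) d c
  rw [MvPowerSeries.subst_self, id, ← Algebra.smul_def] at hX
  rw [map_sub, sub_eq_zero, hm, MvPowerSeries.coeff_embDomain_rename, ← hm] at h
  rw [coeff_shiftHom, MvPowerSeries.subst_monomial (hasSubst_shiftTimes _), ← Algebra.smul_def,
    map_smul, h, ← map_smul, AddMonoidHom.id_apply, ← hX]

theorem shiftHom_succ_one (e : ℤ) (n : ℕ) : shiftHom e (n + 1) (1 : Fn K) = 0 := by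
  classical
  ext m
  rw [coeff_shiftHom, ← map_one (MvPowerSeries.C (σ := ℕ+) (R := K)), MvPowerSeries.subst_C,
    map_one, MvPowerSeries.coeff_one, if_neg, map_zero]
  intro h
  have := DFunLike.congr_fun h (Sum.inr ())
  simp at this

end Shift

/-! ### The shifted dressing operator M(t + e[z]) (1 − ezD)⁻¹. -/

section Spectral

variable {K : Type*} [CommRing K]

/-- An additive map applied to all coefficients of an operator. -/
def PDO.mapCoeff (φ : Fn K →+ Fn K) (A : PDO K) : PDO K where
  coeff k := φ (A.coeff k)
  bdd := by
    obtain ⟨N, hN⟩ := A.bdd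
    exact ⟨N, fun n hn => by rw [hN n hn, map_zero]⟩

theorem PDO.coeff_mapCoeff (φ : Fn K →+ Fn K) (A : PDO K) (k : ℤ) :
    (A.mapCoeff φ).coeff k = φ (A.coeff k) := rfl

theorem PDO.OrdLE.mapCoeff {A : PDO K} {N : ℤ} (hA : A.OrdLE N) (φ : Fn K →+ Fn K) :
    (A.mapCoeff φ).OrdLE N := fun n hn => by rw [coeff_mapCoeff, hA n hn, map_zero]

theorem lmul_eq_finsum {σ : Type*} {F G : ℤ → MvPowerSeries σ K} {k : ℤ}
    (h : (Function.support fun i => F i * G (k - i)).Finite) :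
    lmul F G k = ∑ᶠ i, F i * G (k - i) := by
  ext m
  exact (AddMonoidHom.map_finsum (MvPowerSeries.coeff (R := K) m).toAddMonoidHom h).symm

variable [Algebra ℚ K]

/-- The terms `∑ j + l = n, (P j M) (e D) ^ l` of the shifted dressing operator times
`(1 - e z D)⁻¹`, where `P j` are the coefficients of the shift of the times. -/
def shiftedDressing (e : ℤ) (M : PDO K) (n : ℕ) : PDO K :=
  ∑ p ∈ antidiagonal n, e ^ p.2 • (M.mapCoeff (shiftHom e p.1) * PDO.D p.2)

omit [Algebra ℚ K] in
theorem flow_mul_D (n : ℕ+) (A : PDO K) (i : ℤ) :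
    (A * PDO.D i).flow n = A.flow n * PDO.D i := by
  rw [PDO.flow_mul, PDO.flow_D, mul_zero, add_zero]

theorem shiftedDressing_flow (e : ℤ) (M : PDO K) (k : ℕ+) (n : ℕ) :
    (shiftedDressing e M n).flow k =
      ∑ p ∈ antidiagonal n, e ^ p.2 • ((M.mapCoeff (shiftHom e p.1)).flow k * PDO.D p.2) := by
  change PDO.flowHom k _ = _
  rw [shiftedDressing, map_sum]
  refine sum_congr rfl fun p _ => ?_
  rw [map_zsmul]
  exact congrArg _ (flow_mul_D k _ _)

theorem mapCoeff_shiftHom_succ (e : ℤ) (M : PDO K) (n : ℕ) :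
    ((n + 1 : ℕ) : ℤ) • M.mapCoeff (shiftHom e (n + 1)) =
      e • ∑ p ∈ antidiagonal n, (M.mapCoeff (shiftHom e p.2)).flow p.1.succPNat := by
  ext1; funext k
  rw [PDO.coeff_smul, PDO.coeff_smul, PDO.coeff_sum, PDO.coeff_mapCoeff, shiftHom_succ]
  rfl

/-- Apply z∂_z to M(t + e[z]) (1 − ezD)⁻¹. The first factor contributes through the recurrence for
shifts; the second becomes ezD (1 − ezD)⁻², which multiplies the original series by ∑_(j≥1) (ezD)^j.
-/
theorem shiftedDressing_succ (e : ℤ) (M : PDO K) (n : ℕ) :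
    ((n + 1 : ℕ) : ℤ) • shiftedDressing e M (n + 1) =
      e • ∑ p ∈ antidiagonal n, (shiftedDressing e M p.2).flow p.1.succPNat +
        ∑ p ∈ antidiagonal n, e ^ (p.1 + 1) • (shiftedDressing e M p.2 * PDO.D (p.1 + 1 : ℕ)) := by
  -- Leibniz rule for z∂_z: the total degree n+1 is the degree in the shift plus the degree in ezD.
  have hsplit : ((n + 1 : ℕ) : ℤ) • shiftedDressing e M (n + 1) =
      ∑ p ∈ antidiagonal (n + 1), (p.1 : ℤ) •
        (e ^ p.2 • (M.mapCoeff (shiftHom e p.1) * PDO.D p.2)) +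
      ∑ p ∈ antidiagonal (n + 1), (p.2 : ℤ) •
        (e ^ p.2 • (M.mapCoeff (shiftHom e p.1) * PDO.D p.2)) := by
    rw [shiftedDressing, smul_sum, ← sum_add_distrib]
    refine sum_congr rfl fun p hp => ?_
    rw [← add_smul, ← HasAntidiagonal.mem_antidiagonal.mp hp, Nat.cast_add]
  rw [hsplit, Finset.Nat.sum_antidiagonal_succ, Finset.Nat.sum_antidiagonal_succ']
  simp only [Nat.cast_zero, zero_smul, zero_add]
  congr 1
  · simp only [shiftedDressing_flow]
    rw [← sum_antidiagonal_assoc n fun u j l =>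
      e ^ l • ((M.mapCoeff (shiftHom e j)).flow u.succPNat * PDO.D l), smul_sum]
    refine sum_congr rfl fun p _ => ?_
    rw [smul_comm, ← smul_mul_assoc, mapCoeff_shiftHom_succ, smul_mul_assoc, smul_comm, sum_mul,
      smul_sum]
  · have := sum_antidiagonal_assoc n fun j l u =>
      e ^ (u + l + 1) • (M.mapCoeff (shiftHom e j) * PDO.D (u + l + 1 : ℕ))
    refine Eq.trans ?_ (this.symm.trans ?_)
    · refine sum_congr rfl fun p _ => ?_
      have h : ∀ q ∈ antidiagonal p.2,
          e ^ (q.2 + q.1 + 1) • (M.mapCoeff (shiftHom e p.1) * PDO.D (q.2 + q.1 + 1 : ℕ)) =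
          e ^ (p.2 + 1) • (M.mapCoeff (shiftHom e p.1) * PDO.D (p.2 + 1 : ℕ)) := fun q hq => by
        rw [add_comm q.2, HasAntidiagonal.mem_antidiagonal.mp hq]
      rw [sum_congr rfl h, sum_const, Finset.Nat.card_antidiagonal, ← natCast_zsmul]
    · rw [← Finset.Nat.sum_antidiagonal_swap]
      refine sum_congr rfl fun p _ => ?_
      rw [shiftedDressing, sum_mul, smul_sum]
      refine sum_congr rfl fun q _ => ?_
      rw [Prod.snd_swap, smul_mul_assoc, mul_assoc, PDO.D_mul_D, smul_smul, ← pow_add]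
      congr 2
      · ring
      · congr 1
        push_cast
        ring

end Spectral

/-! ### Dressing pairs and the shift as a series of differential operators. -/

section Spectral

variable {K : Type*} [CommRing K] [Algebra ℚ K]

/-- A dressing operator `M` with sign `e` (for `e = 1` it acts on `exp ξ`, for `e = -1` on
`exp (-ξ)`), the adjoint `N` of its inverse, and the differential operators `C n` that govern the
flows of `M` and of the associated (adjoint) eigenfunctions. -/
structure DressingPair (e : ℤ) (M N : PDO K) (C : ℕ+ → PDO K) : Prop where
  sign : e * e = 1
  lead : M.coeff 0 = 1
  ordLE : M.OrdLE 0
  lead' : N.coeff 0 = 1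
  ordLE' : N.OrdLE 0
  mul_adj : M * N.adj = 1
  adj_mul : N.adj * M = 1
  isDiff : ∀ n, (C n).IsDiff
  flow_eq : ∀ n : ℕ+, M.flow n = C n * M - e ^ ((n : ℕ) + 1) • (M * PDO.D (n : ℕ))

omit [Algebra ℚ K] in
theorem sign_pow_eq {e : ℤ} (he : e * e = 1) {a b : ℕ} (h : Even (a + b)) : e ^ a = e ^ b := by
  have h1 : e ^ (a + b) = 1 := by
    obtain ⟨c, hc⟩ := h
    rw [hc, pow_add, ← mul_pow, he, one_pow]
  have h2 : e ^ b * e ^ b = 1 := by rw [← mul_pow, he, one_pow]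
  rw [pow_add] at h1
  linear_combination e ^ b * h1 - e ^ a * h2

theorem isDiff_of_zsmul {A : PDO K} (n : ℕ) (h : (((n + 1 : ℕ) : ℤ) • A).IsDiff) : A.IsDiff := by
  have : IsAddTorsionFree (Fn K) := .of_module_rat _
  intro k hk
  have := h k hk
  rw [PDO.coeff_smul, natCast_zsmul] at this
  exact (nsmul_eq_zero_iff_right (Nat.succ_ne_zero n)).mp this

/-- The operators `X n` with `Φ (t + e [λ⁻¹]) = ∑ n, λ ^ (-n) X n (Φ)` for eigenfunctions `Φ`. -/
def shiftOp (e : ℤ) (M N : PDO K) (n : ℕ) : PDO K := shiftedDressing e M n * N.adj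

namespace DressingPair

variable {e : ℤ} {M N : PDO K} {C : ℕ+ → PDO K}

theorem shiftOp_mul (h : DressingPair e M N C) (n : ℕ) :
    shiftOp e M N n * M = shiftedDressing e M n := by
  rw [shiftOp, mul_assoc, h.adj_mul, mul_one]

/-- Write the shifted dressing operator as X_k M and insert the flow equation of M: its terms M D^j
cancel the second sum of `shiftedDressing_succ` because e² = 1, and N* removes the common right
factor M. -/
theorem shiftOp_succ (h : DressingPair e M N C) (n : ℕ) :
    ((n + 1 : ℕ) : ℤ) • shiftOp e M N (n + 1) =
      e • ∑ p ∈ antidiagonal n, ((shiftOp e M N p.2).flow p.1.succPNat +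
        shiftOp e M N p.2 * C p.1.succPNat) := by
  have hf : ∀ p : ℕ × ℕ, e • (shiftedDressing e M p.2).flow p.1.succPNat +
      e ^ (p.1 + 1) • (shiftedDressing e M p.2 * PDO.D (p.1 + 1 : ℕ)) =
      e • (((shiftOp e M N p.2).flow p.1.succPNat +
        shiftOp e M N p.2 * C p.1.succPNat) * M) := by
    intro p
    have hp : e * e ^ (p.1 + 1 + 1) = e ^ (p.1 + 1) := by
      linear_combination e ^ (p.1 + 1) * h.sign
    rw [← h.shiftOp_mul, PDO.flow_mul, h.flow_eq, Nat.succPNat_coe, Nat.succ_eq_add_one, add_mul,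
      mul_sub, mul_smul_comm, smul_add, smul_sub, smul_add, smul_smul, hp]
    simp only [mul_assoc]
    abel
  rw [shiftOp, ← smul_mul_assoc, shiftedDressing_succ, smul_sum, ← sum_add_distrib,
    sum_congr rfl fun p _ => hf p, ← smul_sum, ← sum_mul, smul_mul_assoc, mul_assoc, h.mul_adj,
    mul_one]

theorem shiftedDressing_zero : shiftedDressing e M 0 = M := by
  ext1; funext k
  simp only [shiftedDressing, Finset.Nat.antidiagonal_zero, sum_singleton, pow_zero, one_smul]
  rw [PDO.coeff_mul_D, PDO.coeff_mapCoeff, shiftHom_zero]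
  simp

theorem shiftOp_zero (h : DressingPair e M N C) : shiftOp e M N 0 = 1 := by
  rw [shiftOp, shiftedDressing_zero, h.mul_adj]

/-- Invisible from the definition, but the recurrence starts at 1 and uses only flows and products
with the differential C_n; dividing by n+1 uses the ℚ-algebra structure. -/
theorem isDiff_shiftOp (h : DressingPair e M N C) (n : ℕ) : (shiftOp e M N n).IsDiff := by
  induction n using Nat.strong_induction_on with
  | _ n ih =>
    cases n with
    | zero => rw [h.shiftOp_zero]; exact PDO.isDiff_one
    | succ n =>
      refine isDiff_of_zsmul n ?_
      rw [h.shiftOp_succ]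
      refine PDO.IsDiff.zsmul (PDO.IsDiff.sum fun p hp => ?_) _
      have := ih p.2 (by have := HasAntidiagonal.mem_antidiagonal.mp hp; omega)
      exact (this.flow _).add (this.mul (h.isDiff _))

/-- Both sides start at Φ and obey the same recurrence, as ∂_j(X Φ) = (∂_j X + X C_j)(Φ) for
differential X. -/
theorem shiftHom_eq_plusApply (h : DressingPair e M N C) {Φ : Fn K}
    (hΦ : ∀ n, dt n Φ = (C n).plusApply Φ) (n : ℕ) :
    shiftHom e n Φ = (shiftOp e M N n).plusApply Φ := by
  have : IsAddTorsionFree (Fn K) := .of_module_rat _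
  induction n using Nat.strong_induction_on with
  | _ n ih =>
    cases n with
    | zero => rw [shiftHom_zero, h.shiftOp_zero, PDO.one_plusApply]
    | succ n =>
      refine nsmul_right_injective (M := Fn K) (Nat.succ_ne_zero n) ?_
      change (n + 1) • shiftHom e (n + 1) Φ = (n + 1) • PDO.plusApplyHom Φ (shiftOp e M N (n + 1))
      rw [← map_nsmul (PDO.plusApplyHom Φ), ← natCast_zsmul, ← natCast_zsmul, h.shiftOp_succ,
        shiftHom_succ, map_zsmul, map_sum]
      congr 1
      refine sum_congr rfl fun p hp => ?_
      rw [ih p.2 (by have := HasAntidiagonal.mem_antidiagonal.mp hp; omega), PDO.dt_plusApply, hΦ,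
        ← PDO.plusApply_mul (h.isDiff_shiftOp _) (h.isDiff _), map_add]
      rfl

/-- The coefficients of `λ ^ (-b)` in the shifted symbol of the dressing operator. -/
def shiftedSymbol (e : ℤ) (M : PDO K) (b : ℕ) : Fn K :=
  ∑ j ∈ range (b + 1), e ^ (b + j) • shiftHom e j (M.coeff (j - b))

/-- Down to D⁻¹ inclusive, the coefficients for all n come from one symbol, that of M(t + e[z]) at
eλ. -/
theorem coeff_shiftedDressing (h : DressingPair e M N C) {n b : ℕ} (hb : b ≤ n + 1) :
    (shiftedDressing e M n).coeff (n - b) = e ^ (n + b) • shiftedSymbol e M b := by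
  have h1 : (shiftedDressing e M n).coeff (n - b) =
      ∑ j ∈ range (n + 1), e ^ (n + j) • shiftHom e j (M.coeff (j - b)) := by
    rw [shiftedDressing, PDO.coeff_sum, Finset.Nat.sum_antidiagonal_eq_sum_range_succ_mk]
    refine sum_congr rfl fun j hj => ?_
    have hj := mem_range.mp hj
    rw [PDO.coeff_smul, PDO.coeff_mul_D, PDO.coeff_mapCoeff,
      sign_pow_eq h.sign (a := n - j) (b := n + j) ⟨n, by omega⟩,
      show (n - b - (n - j : ℕ) : ℤ) = j - b by omega]
  rw [h1, shiftedSymbol, smul_sum]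
  have h2 : ∀ j ∈ range (b + 1), e ^ (n + b) • e ^ (b + j) • shiftHom e j (M.coeff (j - b)) =
      e ^ (n + j) • shiftHom e j (M.coeff (j - b)) := fun j _ => by
    rw [smul_smul, ← pow_add, sign_pow_eq h.sign (b := n + j) ⟨n + b + j, by ring⟩]
  rw [sum_congr rfl h2]
  rcases Nat.lt_or_ge n b with hlt | hle
  -- The D⁻¹ coefficient: the symbol has one term too many, j = n+1, but it shifts the leading
  -- coefficient 1 and so vanishes.
  · obtain rfl : b = n + 1 := by omega
    rw [sum_range_succ _ (n + 1), sub_self, h.lead, shiftHom_succ_one, smul_zero, add_zero]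
  · refine (sum_subset (fun j hj => ?_) fun j hj hj' => ?_).symm
    · simp only [mem_range] at hj ⊢; omega
    · simp only [mem_range] at hj hj'
      rw [h.ordLE _ (by omega), map_zero, smul_zero]

theorem ordLE_shiftedDressing (h : DressingPair e M N C) (n : ℕ) :
    (shiftedDressing e M n).OrdLE n := by
  refine PDO.OrdLE.sum fun p hp => PDO.OrdLE.smul ?_ _
  have := HasAntidiagonal.mem_antidiagonal.mp hp
  exact ((h.ordLE.mapCoeff _).mul (PDO.ordLE_D _)).mono (by omega)

/-- The coefficient of `λ ^ (-i)` in the dual symbol. -/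
def dualSymbol (e : ℤ) (N : PDO K) (i : ℕ) : Fn K := (-e) ^ i • N.coeff (-i)

/-- X_n is differential, so its D⁻¹ coefficient is 0; by `PDO.coeff_neg_one_mul_adj` that
coefficient is, up to sign, the degree n+1 part of the product of the two symbols. -/
theorem sum_dualSymbol_mul_shiftedSymbol (h : DressingPair e M N C) (n : ℕ) :
    ∑ p ∈ antidiagonal n, dualSymbol e N p.1 * shiftedSymbol e M p.2 = if n = 0 then 1 else 0 := by
  cases n with
  | zero =>
    simp [dualSymbol, shiftedSymbol, h.lead, h.lead', shiftHom_zero]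
  | succ n =>
    rw [if_neg (Nat.succ_ne_zero n)]
    have hX := h.isDiff_shiftOp n (-1) (by norm_num)
    have hinj : Set.InjOn (fun p : ℕ × ℕ => (n - p.2 : ℤ))
        (antidiagonal (n + 1) : Set (ℕ × ℕ)) := by
      rintro ⟨a, b⟩ h1 ⟨a', b'⟩ h2 h
      simp only [Prod.mk.injEq, mem_coe, HasAntidiagonal.mem_antidiagonal] at h h1 h2 ⊢
      omega
    rw [shiftOp, PDO.coeff_neg_one_mul_adj, finsum_eq_finsetSum_of_support_subset
      (s := (antidiagonal (n + 1)).image fun p : ℕ × ℕ => (n - p.2 : ℤ)), sum_image hinj] at hX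
    · have h3 : ∀ p ∈ antidiagonal (n + 1), (shiftedDressing e M n).coeff (n - p.2) *
          (((n - p.2 + 1 : ℤ).negOnePow : ℤ) • N.coeff (-1 - (n - p.2))) =
          e • (dualSymbol e N p.1 * shiftedSymbol e M p.2) := fun p hp => by
        have hp := HasAntidiagonal.mem_antidiagonal.mp hp
        have h4 : (((n - p.2 + 1 : ℤ).negOnePow : ℤˣ) : ℤ) = (-1) ^ p.1 := by
          rw [show (n - p.2 + 1 : ℤ) = (p.1 : ℕ) by omega]
          simp [Int.negOnePow_def]
        have h5 : (-1 - (n - p.2) : ℤ) = -p.1 := by omega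
        have h6 : e ^ (n + p.2) = e * e ^ p.1 := by
          rw [← pow_succ']
          exact sign_pow_eq h.sign ⟨n + 1, by omega⟩
        rw [h.coeff_shiftedDressing (by omega), h4, h5, h6, dualSymbol]
        simp only [mul_smul_comm, smul_mul_assoc, smul_smul]
        rw [mul_comm (N.coeff _)]
        congr 1
        rw [neg_pow e]
        ring
      rw [sum_congr rfl h3, ← smul_sum] at hX
      have := congrArg (e • ·) hX
      simpa only [smul_smul, h.sign, one_smul, smul_zero] using this
    · intro j hj
      have h1 : j ≤ n := by
        by_contra hlt
        exact hj (by simp only [h.ordLE_shiftedDressing n j (by omega), zero_mul])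
      have h2 : -1 ≤ j := by
        by_contra hlt
        exact hj (by simp only [h.ordLE' (-1 - j) (by omega), smul_zero, mul_zero])
      simp only [coe_image, Set.mem_image, mem_coe, HasAntidiagonal.mem_antidiagonal, Prod.exists]
      exact ⟨(j + 1).toNat, (n - j).toNat, by omega, by omega⟩

/-- The coefficient of D^(n−b) is, up to sign, the degree b part of a product of inverse symbols, so
only b = 0 survives. Negative orders may be ignored: multiplied by N*, of order 0, they still do not
act on Φ. -/
theorem sum_dualSymbol_shiftedDressing_ordLE (h : DressingPair e M N C) (n : ℕ) :
    (∑ p ∈ antidiagonal n, PDO.mono (dualSymbol e N p.1) 0 * shiftedDressing e M p.2 -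
      e ^ n • PDO.D n).OrdLE (-1) := by
  intro k hk
  rw [PDO.coeff_sub, PDO.coeff_sum, PDO.coeff_smul, ← PDO.mono_one, PDO.coeff_mono]
  simp only [PDO.coeff_mono_zero_mul]
  by_cases hkn : (n : ℤ) < k
  · rw [if_neg (by omega), smul_zero, sub_zero]
    refine sum_eq_zero fun p hp => ?_
    have := HasAntidiagonal.mem_antidiagonal.mp hp
    rw [h.ordLE_shiftedDressing p.2 k (by omega), mul_zero]
  obtain ⟨b, rfl⟩ : ∃ b : ℕ, k = n - b := ⟨(n - k).toNat, by omega⟩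
  have hsum := h.sum_dualSymbol_mul_shiftedSymbol b
  rw [Finset.Nat.sum_antidiagonal_eq_sum_range_succ_mk] at hsum
  rw [Finset.Nat.sum_antidiagonal_eq_sum_range_succ_mk,
    ← sum_subset (s₁ := range (b + 1)) (fun j hj => by
      simp only [mem_range] at hj ⊢; omega) fun j hj hj' => ?_]
  · have h1 : ∀ j ∈ range (b + 1), dualSymbol e N j *
        (shiftedDressing e M (n - j)).coeff (n - b) =
        e ^ (n + b) • (dualSymbol e N j * shiftedSymbol e M (b - j)) := fun j hj => by
      have hj := mem_range.mp hj
      have h2 : (n - b : ℤ) = (n - j : ℕ) - (b - j : ℕ) := by omega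
      rw [h2, h.coeff_shiftedDressing (by omega), mul_smul_comm,
        sign_pow_eq h.sign (b := n + b) ⟨n + b - j, by omega⟩]
    rw [sum_congr rfl h1, ← smul_sum, hsum]
    by_cases hb : b = 0
    · subst hb; simp
    · rw [if_neg hb, if_neg (by omega), smul_zero, smul_zero, sub_zero]
  · simp only [mem_range] at hj hj'
    rw [h.ordLE_shiftedDressing _ _ (by omega), mul_zero]

theorem sum_dualSymbol_mul_shiftHom (h : DressingPair e M N C) {Φ : Fn K}
    (hΦ : ∀ n, dt n Φ = (C n).plusApply Φ) (n : ℕ) :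
    ∑ p ∈ antidiagonal n, dualSymbol e N p.1 * shiftHom e p.2 Φ =
      e ^ n • (PDO.D n * N.adj).plusApply Φ := by
  have h1 := PDO.plusApply_of_ordLE
    (add_zero (-1 : ℤ) ▸ (h.sum_dualSymbol_shiftedDressing_ordLE n).mul h.ordLE'.adj) Φ
  rw [sub_mul, sum_mul, smul_mul_assoc] at h1
  have h2 := (map_sub (PDO.plusApplyHom Φ) _ _).symm.trans h1
  rw [sub_eq_zero, map_sum, map_zsmul] at h2
  refine Eq.trans (sum_congr rfl fun p _ => ?_) h2
  rw [h.shiftHom_eq_plusApply hΦ, mul_assoc]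
  exact (PDO.plusApply_mono_zero_mul _ _ _).symm

end DressingPair

end Spectral

/-! ### Functions of two multi-times and restriction to t = t'. -/

section Diagonal

variable {K : Type*} [CommRing K]

instance tendstoCofinite_sumElim_id :
    Filter.TendstoCofinite (Sum.elim id id : ℕ+ ⊕ ℕ+ → ℕ+) := by
  rw [Filter.tendstoCofinite_iff_finite_preimage_singleton]
  refine fun n => ({Sum.inl n, Sum.inr n} : Finset (ℕ+ ⊕ ℕ+)).finite_toSet.subset ?_
  rintro (i | i) h <;> simpa using h

/-- The restriction of a function of `(t, t')` to the diagonal `t = t'`. -/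
def diag : Fn2 K →+* Fn K := (MvPowerSeries.rename (Sum.elim id id : ℕ+ ⊕ ℕ+ → ℕ+)).toRingHom

theorem isFinitary_diag : IsFinitary (diag (K := K)).toAddMonoidHom := isFinitary_rename _

theorem diag_atT (f : Fn K) : diag (atT f) = f := by
  refine (MvPowerSeries.rename_rename _ _ f).trans ?_
  exact MvPowerSeries.rename_id_apply f

theorem diag_atT' (f : Fn K) : diag (atT' f) = f := by
  refine (MvPowerSeries.rename_rename _ _ f).trans ?_
  exact MvPowerSeries.rename_id_apply f

theorem constantCoeff_diag (f : Fn2 K) :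
    MvPowerSeries.constantCoeff (diag f) = MvPowerSeries.constantCoeff f :=
  MvPowerSeries.constantCoeff_rename _ f

theorem diag_X (i : ℕ+ ⊕ ℕ+) :
    diag (MvPowerSeries.X i : Fn2 K) = MvPowerSeries.X (Sum.elim id id i) :=
  MvPowerSeries.rename_X _ i

theorem dt_diag (n : ℕ+) (f : Fn2 K) : dt n (diag f) =
    diag (MvPowerSeries.pderiv K (Sum.inl n) f) + diag (MvPowerSeries.pderiv K (Sum.inr n) f) := by
  classical
  refine IsFinitary.eq_of_monomial ((isFinitary_pderiv (K := K) n).comp isFinitary_diag)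
    ((isFinitary_diag.comp (isFinitary_pderiv (Sum.inl n))).add
      (isFinitary_diag.comp (isFinitary_pderiv (Sum.inr n)))) (fun d c => ?_) f
  change dt n (diag _) =
    diag (MvPowerSeries.pderiv K (Sum.inl n) _) + diag (MvPowerSeries.pderiv K (Sum.inr n) _)
  rw [← MvPolynomial.coe_monomial]
  induction MvPolynomial.monomial d c using MvPolynomial.induction_on with
  | C a =>
    have : diag (MvPowerSeries.C a : Fn2 K) = MvPowerSeries.C a := MvPowerSeries.rename_C _ a
    rw [MvPolynomial.coe_C, this]
    simp [dt]
  | add p q hp hq =>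
    rw [dt] at hp hq
    rw [MvPolynomial.coe_add, map_add, dt, map_add, hp, hq]
    simp only [map_add]
    abel
  | mul_X p i hp =>
    rw [dt] at hp
    rw [MvPolynomial.coe_mul, MvPolynomial.coe_X, map_mul, dt]
    simp only [Derivation.leibniz, smul_eq_mul, map_add, map_mul, hp, diag_X]
    rcases i with i | i
    · rw [MvPowerSeries.pderiv_X_of_ne (i := Sum.inr n) (j := Sum.inl i) (by simp)]
      by_cases h : i = n
      · subst h
        simp only [Sum.elim_inl, id, MvPowerSeries.pderiv_X_self, map_one, map_zero]
        ring
      · rw [MvPowerSeries.pderiv_X_of_ne (i := Sum.inl n) (j := Sum.inl i) (by simpa using h)]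
        simp only [Sum.elim_inl, id, MvPowerSeries.pderiv_X_of_ne h, map_zero]
        ring
    · rw [MvPowerSeries.pderiv_X_of_ne (i := Sum.inl n) (j := Sum.inr i) (by simp)]
      by_cases h : i = n
      · subst h
        simp only [Sum.elim_inr, id, MvPowerSeries.pderiv_X_self, map_one, map_zero]
        ring
      · rw [MvPowerSeries.pderiv_X_of_ne (i := Sum.inr n) (j := Sum.inr i) (by simpa using h)]
        simp only [Sum.elim_inr, id, MvPowerSeries.pderiv_X_of_ne h, map_zero]
        ring

/-- Taylor expansion in characteristic zero: up to a factorial factor, each coefficient of f is the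
constant term of an iterated derivative. -/
theorem eq_zero_of_closed_pderiv [Algebra ℚ K] {σ : Type*} (S : Set (MvPowerSeries σ K))
    (hS : ∀ f ∈ S, ∀ i, MvPowerSeries.pderiv K i f ∈ S)
    (h0 : ∀ f ∈ S, MvPowerSeries.constantCoeff f = 0) : ∀ f ∈ S, f = 0 := by
  classical
  have : IsAddTorsionFree K := .of_module_rat K
  suffices h : ∀ d : ℕ, ∀ m : σ →₀ ℕ, m.degree = d → ∀ f ∈ S, MvPowerSeries.coeff m f = 0 from
    fun f hf => by
      ext m
      rw [h _ m rfl f hf, map_zero]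
  intro d
  induction d with
  | zero =>
    intro m hm f hf
    rw [(Finsupp.degree_eq_zero_iff m).mp hm, MvPowerSeries.coeff_zero_eq_constantCoeff_apply,
      h0 f hf]
  | succ d ih =>
    intro m hm f hf
    obtain ⟨i, hi⟩ : ∃ i, m i ≠ 0 := by
      by_contra! hcon
      have hm0 : m = 0 := Finsupp.ext hcon
      rw [hm0, map_zero] at hm
      omega
    have hs : m - Finsupp.single i 1 + Finsupp.single i 1 = m :=
      tsub_add_cancel_of_le (Finsupp.single_le_iff.mpr (Nat.one_le_iff_ne_zero.mpr hi))
    have hd : (m - Finsupp.single i 1).degree = d := by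
      have := congrArg Finsupp.degree hs
      rw [map_add, hm, Finsupp.degree_single] at this
      omega
    have := ih _ hd _ (hS f hf i)
    rw [MvPowerSeries.coeff_pderiv, hs, ← Nat.cast_add_one, ← nsmul_eq_mul'] at this
    exact (nsmul_eq_zero_iff_right (Nat.succ_ne_zero _)).mp this

/-- A family of functions of `(t, t')` that is closed under the derivatives in `t` and vanishes on
the diagonal is zero. -/
theorem eq_zero_of_closed_of_diag [Algebra ℚ K] (S : Set (Fn2 K))
    (hS : ∀ f ∈ S, ∀ n, MvPowerSeries.pderiv K (Sum.inl n) f ∈ S)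
    (h0 : ∀ f ∈ S, diag f = 0) : ∀ f ∈ S, f = 0 := by
  -- By the chain rule on the diagonal, the t'-derivatives of such a family form another such
  -- family, so the union of all of them is closed under every derivative.
  refine fun f hf => eq_zero_of_closed_pderiv {f : Fn2 K | ∃ S : Set (Fn2 K), (∀ f ∈ S, ∀ n,
    MvPowerSeries.pderiv K (Sum.inl n) f ∈ S) ∧ (∀ f ∈ S, diag f = 0) ∧ f ∈ S} ?_ ?_ f
    ⟨S, hS, h0, hf⟩
  · rintro f ⟨S, hS, h0, hf⟩ (n | n)
    · exact ⟨S, hS, h0, hS f hf n⟩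
    · refine ⟨MvPowerSeries.pderiv K (Sum.inr n) '' S, ?_, ?_, Set.mem_image_of_mem _ hf⟩
      · rintro _ ⟨g, hg, rfl⟩ k
        exact ⟨_, hS g hg k, pderiv_comm _ _ _⟩
      · rintro _ ⟨g, hg, rfl⟩
        have h := dt_diag n g
        rw [h0 g hg, h0 _ (hS g hg n), dt, map_zero, zero_add] at h
        exact h.symm
  · rintro f ⟨S, -, h0, hf⟩
    rw [← constantCoeff_diag, h0 f hf, map_zero]

theorem pderiv_rename {σ τ : Type*} (e : σ ↪ τ) (i : σ) (f : MvPowerSeries σ K) :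
    MvPowerSeries.pderiv K (e i) (MvPowerSeries.rename e f) =
      MvPowerSeries.rename e (MvPowerSeries.pderiv K i f) := by
  ext m
  rw [MvPowerSeries.coeff_pderiv]
  by_cases hm : m ∈ Set.range (Finsupp.mapDomain e)
  · obtain ⟨a, rfl⟩ := hm
    rw [← Finsupp.embDomain_eq_mapDomain, MvPowerSeries.coeff_embDomain_rename,
      MvPowerSeries.coeff_pderiv, ← Finsupp.embDomain_single, ← Finsupp.embDomain_add,
      MvPowerSeries.coeff_embDomain_rename, Finsupp.embDomain_apply_self]
  · rw [MvPowerSeries.coeff_rename_eq_zero _ _ hm, MvPowerSeries.coeff_rename_eq_zero, zero_mul]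
    rw [Finsupp.mem_range_mapDomain_iff _ e.injective] at hm ⊢
    refine fun h => hm fun j hj => ?_
    have := h j hj
    rw [Finsupp.add_apply] at this
    omega

theorem pderiv_rename_of_notMem {σ τ : Type*} (e : σ ↪ τ) {i : τ} (hi : i ∉ Set.range e)
    (f : MvPowerSeries σ K) : MvPowerSeries.pderiv K i (MvPowerSeries.rename e f) = 0 := by
  ext m
  rw [MvPowerSeries.coeff_pderiv, MvPowerSeries.coeff_rename_eq_zero, zero_mul, map_zero]
  rw [Finsupp.mem_range_mapDomain_iff _ e.injective]
  intro h
  have := h i hi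
  rw [Finsupp.add_apply, Finsupp.single_eq_same] at this
  omega

theorem pderiv_atT (n : ℕ+) (f : Fn K) :
    MvPowerSeries.pderiv K (Sum.inl n) (atT f) = atT (dt n f) :=
  pderiv_rename Function.Embedding.inl n f

theorem pderiv_inl_atT' (n : ℕ+) (f : Fn K) :
    MvPowerSeries.pderiv K (Sum.inl n) (atT' f) = 0 :=
  pderiv_rename_of_notMem _ (by simp) f

theorem pderiv_inr_atT (n : ℕ+) (f : Fn K) :
    MvPowerSeries.pderiv K (Sum.inr n) (atT f) = 0 :=
  pderiv_rename_of_notMem _ (by simp) f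

theorem killCompl_inl_atT' (f : Fn K) :
    MvPowerSeries.killCompl Function.Embedding.inl (atT' f) = atZero f := by
  classical
  ext m
  rw [MvPowerSeries.coeff_killCompl, MvPowerSeries.coeff_C]
  split_ifs with h
  · subst h
    rw [Finsupp.embDomain_zero, MvPowerSeries.coeff_zero_eq_constantCoeff_apply]
    exact MvPowerSeries.constantCoeff_rename _ f
  · refine MvPowerSeries.coeff_rename_eq_zero _ _ ?_
    rw [Finsupp.mem_range_mapDomain_iff _ Function.Embedding.inr.injective]
    intro hcon
    refine h (Finsupp.ext fun i => ?_)
    have := hcon (Sum.inl i) (by simp)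
    rwa [show (Sum.inl i : ℕ+ ⊕ ℕ+) = Function.Embedding.inl i from rfl,
      Finsupp.embDomain_apply_self] at this

end Diagonal

/-! ### The spectral integral and its evaluation. -/

section Representation

variable {K : Type*} [CommRing K] [Algebra ℚ K]

/-- The symbol of `A` at `ε λ`. -/
def symbolSeries (ε : ℤˣ) (A : PDO K) : ℤ → Fn K := fun k => ((ε ^ k : ℤˣ) : ℤ) • A.coeff k

/-- The function `A (exp (ε ξ))`. -/
def waveSeries (ε : ℤˣ) (A : PDO K) : ℤ → Fn K := lmul (symbolSeries ε A) (expXi ((ε : ℤ) : ℚ))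

/-- The spectral density of `Φ` for the dual operator `N`. -/
def densitySeries (ε : ℤˣ) (N : PDO K) (Φ : Fn K) : ℤ → Fn K :=
  divLambda (lmul (waveSeries (-ε) N) (shift ((ε : ℤ) : ℚ) Φ))

omit [Algebra ℚ K] in
theorem tame_symbolSeries (ε : ℤˣ) (A : PDO K) : Tame timeWt (symbolSeries ε A) :=
  (Tame.of_bdd A.bdd).zsmul _

theorem tame_waveSeries (ε : ℤˣ) (A : PDO K) : Tame timeWt (waveSeries ε A) :=
  (tame_symbolSeries ε A).lmul (tame_expXi _)

theorem shift_of_pos (ε : ℚ) (f : Fn K) {k : ℤ} (hk : 0 < k) : shift ε f k = 0 := by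
  funext m
  exact if_neg (by omega)

theorem tame_shift (ε : ℚ) (f : Fn K) : Tame timeWt (shift ε f) :=
  Tame.of_bdd ⟨0, fun _ => shift_of_pos ε f⟩

theorem tame_densitySeries (ε : ℤˣ) (N : PDO K) (Φ : Fn K) :
    Tame timeWt (densitySeries ε N Φ) :=
  ((tame_waveSeries _ _).lmul (tame_shift _ _)).divLambda

omit [Algebra ℚ K] in
theorem Tame.atT {F : ℤ → Fn K} (h : Tame timeWt F) :
    Tame (Sum.elim timeWt timeWt) fun k => atT (F k) :=
  h.rename Function.Embedding.inl fun _ => rfl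

omit [Algebra ℚ K] in
theorem Tame.atT' {F : ℤ → Fn K} (h : Tame timeWt F) :
    Tame (Sum.elim timeWt timeWt) fun k => atT' (F k) :=
  h.rename Function.Embedding.inr fun _ => rfl

omit [Algebra ℚ K] in
theorem Tame.atZero {F : ℤ → Fn K} (h : Tame timeWt F) : Tame timeWt fun k => atZero (F k) := by
  classical
  obtain ⟨c, hc⟩ := h
  refine ⟨c, fun k m hk => ?_⟩
  rw [MvPowerSeries.coeff_C]
  split_ifs with hm
  · subst hm
    exact hc k 0 hk
  · rfl

theorem zpow_sub_natCast (ε : ℤˣ) (k : ℤ) (n : ℕ) : ε ^ (k - n) = ε ^ k * ε ^ n := by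
  rw [zpow_sub, zpow_natCast, ← inv_pow, Int.units_inv_eq_self]

/-- ∂_n brings down ελⁿ from the exponential while Dⁿ brings down (ελ)ⁿ; the two differ by ε^(n+1).
-/
theorem dt_waveSeries (ε : ℤˣ) (A : PDO K) (n : ℕ+) (k : ℤ) :
    dt n (waveSeries ε A k) =
      waveSeries ε (A.flow n + (ε : ℤ) ^ ((n : ℕ) + 1) • (A * PDO.D (n : ℕ))) k := by
  have hE : (fun j => dt n (expXi (K := K) ((ε : ℤ) : ℚ) j)) =
      fun j => (ε : ℤ) • expXi ((ε : ℤ) : ℚ) (j - (n : ℕ)) := by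
    funext j
    rw [dt_expXi, map_intCast, Int.cast_smul_eq_zsmul]
  have hs : symbolSeries ε (A.flow n + (ε : ℤ) ^ ((n : ℕ) + 1) • (A * PDO.D (n : ℕ))) =
      fun j => dt n (symbolSeries ε A j) + (ε : ℤ) • symbolSeries ε A (j - (n : ℕ)) := by
    funext j
    simp only [symbolSeries]
    rw [PDO.coeff_add, PDO.coeff_smul, PDO.coeff_mul_D, PDO.coeff_flow, smul_add, smul_smul,
      smul_smul, zpow_sub_natCast]
    simp only [dt, map_zsmul]
    congr 2
    push_cast
    ring
  have ht := tame_symbolSeries ε A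
  rw [waveSeries, dt, pderiv_lmul ht (tame_expXi _), waveSeries, hs,
    lmul_add_left (F := fun j => dt n (symbolSeries ε A j))
      (F' := fun j => (ε : ℤ) • symbolSeries ε A (j - (n : ℕ)))
      ((ht.pderiv n).mulDefined (tame_expXi _))
      (((ht.comp_add (-(n : ℕ))).zsmul fun _ => ε).mulDefined (tame_expXi _)),
    hE, lmul_zsmul_comm, lmul_comp_sub]

theorem lmul_symbolSeries_shift {ε : ℤˣ} {M N : PDO K} {C : ℕ+ → PDO K}
    (h : DressingPair ε M N C) {Φ : Fn K} (hΦ : ∀ n, dt n Φ = (C n).plusApply Φ) (k : ℤ) :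
    lmul (symbolSeries (-ε) N) (shift ((ε : ℤ) : ℚ) Φ) k =
      ((ε ^ k : ℤˣ) : ℤ) • (PDO.D (-k) * N.adj).plusApply Φ := by
  have hsupp : (Function.support fun i => symbolSeries (-ε) N i *
      shift ((ε : ℤ) : ℚ) Φ (k - i)) ⊆ Set.Icc k 0 := by
    intro i hi
    by_contra hcon
    refine hi ?_
    simp only [Set.mem_Icc, not_and_or, not_le] at hcon
    rcases hcon with hlt | hlt
    · simp only [shift_of_pos _ _ (show 0 < k - i by omega), mul_zero]
    · simp only [symbolSeries, h.ordLE' i hlt, smul_zero, zero_mul]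
  rw [lmul_eq_finsum ((Set.finite_Icc k 0).subset hsupp)]
  -- Neither side has positive powers of λ: on the right, D^(−k) N* then has negative order.
  by_cases hk : 0 < k
  · rw [PDO.plusApply_of_ordLE (((PDO.ordLE_D _).mul h.ordLE'.adj).mono (by omega)), smul_zero,
      ← finsum_zero (α := ℤ)]
    refine finsum_congr fun i => ?_
    by_contra hi
    have := hsupp hi
    simp only [Set.mem_Icc] at this
    omega
  · obtain ⟨n, rfl⟩ : ∃ n : ℕ, k = -n := ⟨(-k).toNat, by omega⟩
    have hinj : Set.InjOn (fun p : ℕ × ℕ => (-p.1 : ℤ)) (antidiagonal n : Set (ℕ × ℕ)) := by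
      rintro ⟨a, b⟩ h1 ⟨a', b'⟩ h2 h
      simp only [Prod.mk.injEq, mem_coe, HasAntidiagonal.mem_antidiagonal] at h h1 h2 ⊢
      omega
    have hz : ∀ (η : ℤˣ) (n : ℕ), η ^ (-n : ℤ) = η ^ n := fun η n => by
      have := zpow_sub_natCast η 0 n
      rwa [zero_sub, zpow_zero, one_mul] at this
    rw [neg_neg, hz, Units.val_pow_eq_pow_val, ← h.sum_dualSymbol_mul_shiftHom hΦ,
      finsum_eq_finsetSum_of_support_subset
        (s := (antidiagonal n).image fun p : ℕ × ℕ => (-p.1 : ℤ)), sum_image hinj]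
    · refine sum_congr rfl fun p hp => ?_
      have hp := HasAntidiagonal.mem_antidiagonal.mp hp
      rw [show (-n - -p.1 : ℤ) = -(p.2 : ℕ) by omega, shift_neg, symbolSeries, hz,
        Units.val_pow_eq_pow_val, Units.val_neg]
      rfl
    · refine hsupp.trans fun i hi => ?_
      simp only [Set.mem_Icc] at hi
      simp only [coe_image, Set.mem_image, mem_coe, HasAntidiagonal.mem_antidiagonal, Prod.exists]
      exact ⟨(-i).toNat, (n + i).toNat, by omega, by omega⟩

/-- The residue `∫ dλ φ (t', λ) A (exp (ε ξ (t, λ)))` for the spectral density `φ` of `Φ`. -/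
def spectralIntegral (ε : ℤˣ) (N : PDO K) (Φ : Fn K) (A : PDO K) : Fn2 K :=
  residue (lmul (fun k => atT' (densitySeries ε N Φ k)) fun k => atT (waveSeries ε A k))

theorem mulDefined_spectralIntegral (ε : ℤˣ) (N : PDO K) (Φ : Fn K) (A : PDO K) :
    MulDefined (fun k => atT' (densitySeries ε N Φ k)) fun k => atT (waveSeries ε A k) :=
  (tame_densitySeries ε N Φ).atT'.mulDefined (tame_waveSeries ε A).atT

/-- At t = t' the exponentials cancel, and the residue pairs the symbol of A with the series of
`lmul_symbolSeries_shift`; the signs ε^i and ε^(−i) cancel. -/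
theorem diag_spectralIntegral {ε : ℤˣ} {M N : PDO K} {C : ℕ+ → PDO K}
    (h : DressingPair ε M N C) {Φ : Fn K} (hΦ : ∀ n, dt n Φ = (C n).plusApply Φ) (A : PDO K) :
    diag (spectralIntegral ε N Φ A) = (A * N.adj).plusApply Φ := by
  have hE := lmul_expXi_expXi_neg (K := K) (((-ε : ℤˣ) : ℤ) : ℚ)
  rw [show -(((-ε : ℤˣ) : ℤ) : ℚ) = ((ε : ℤ) : ℚ) by push_cast; ring] at hE
  have hi : ∀ i, symbolSeries ε A i * lmul (symbolSeries (-ε) N) (shift ((ε : ℤ) : ℚ) Φ) (0 - i) =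
      A.coeff i * (PDO.D i * N.adj).plusApply Φ := fun i => by
    rw [lmul_symbolSeries_shift h hΦ, zero_sub, neg_neg, symbolSeries, smul_mul_smul_comm,
      ← Units.val_mul, ← zpow_add, add_neg_cancel, zpow_zero, Units.val_one, one_smul]
  rw [spectralIntegral, residue, isFinitary_diag.map_lmul (mulDefined_spectralIntegral ε N Φ A)]
  simp only [diag_atT, diag_atT']
  refine (residue_lmul_cancel (tame_symbolSeries _ _) (tame_symbolSeries _ _) (tame_shift _ _)
    (tame_expXi _) (tame_expXi _) hE).trans ?_
  rw [PDO.plusApply_mul_eq_finsum A h.ordLE'.adj, lmul_eq_finsum]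
  · exact finsum_congr hi
  · simp only [hi]
    exact PDO.mul_coeff_support_finite (m := 0) fun n hn =>
      PDO.plusApply_of_ordLE (((PDO.ordLE_D _).mul h.ordLE'.adj).mono (by omega)) _

theorem pderiv_spectralIntegral (ε : ℤˣ) (N : PDO K) (Φ : Fn K) (A : PDO K) (n : ℕ+) :
    MvPowerSeries.pderiv K (Sum.inl n) (spectralIntegral ε N Φ A) =
      spectralIntegral ε N Φ (A.flow n + (ε : ℤ) ^ ((n : ℕ) + 1) • (A * PDO.D (n : ℕ))) := by
  rw [spectralIntegral, residue,
    pderiv_lmul (tame_densitySeries ε N Φ).atT' (tame_waveSeries ε A).atT]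
  simp only [pderiv_atT, pderiv_inl_atT', dt_waveSeries]
  refine add_eq_right.mpr ?_
  ext m
  simp [coeff_lmul]

theorem DressingPair.spectralIntegral_eq {ε : ℤˣ} {M N : PDO K} {C : ℕ+ → PDO K}
    (h : DressingPair ε M N C) {Φ : Fn K} (hΦ : ∀ n, dt n Φ = (C n).plusApply Φ) :
    spectralIntegral ε N Φ M = atT Φ := by
  -- The defect is studied for all differential X at once: the t-derivatives lead from X = 1 to
  -- X.flow n + X * C n.
  let R : PDO K → Fn2 K := fun X => spectralIntegral ε N Φ (X * M) - atT (X.plusApply Φ)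
  have hS : ∀ f ∈ R '' {X | X.IsDiff}, f = 0 := by
    refine eq_zero_of_closed_of_diag _ ?_ ?_
    · rintro _ ⟨X, hX, rfl⟩ n
      refine ⟨X.flow n + X * C n, (hX.flow n).add (hX.mul (h.isDiff n)), ?_⟩
      simp only [R]
      rw [map_sub, pderiv_spectralIntegral, pderiv_atT, PDO.dt_plusApply, hΦ,
        ← PDO.plusApply_mul hX (h.isDiff n), PDO.flow_mul, h.flow_eq]
      congr 2
      · rw [mul_sub, mul_smul_comm, ← mul_assoc, ← mul_assoc, add_mul]
        abel
      · exact map_add (PDO.plusApplyHom Φ) _ _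
    · rintro _ ⟨X, hX, rfl⟩
      simp only [R]
      rw [map_sub, diag_spectralIntegral h hΦ, diag_atT, mul_assoc, h.mul_adj, mul_one, sub_self]
  have := hS (R 1) ⟨1, PDO.isDiff_one, rfl⟩
  simp only [R] at this
  rwa [one_mul, PDO.one_plusApply, sub_eq_zero] at this

theorem mulDefined_atZero_density (ε : ℤˣ) (N : PDO K) (Φ : Fn K) (A : PDO K) :
    MulDefined (fun k => atZero (densitySeries ε N Φ k)) (waveSeries ε A) :=
  (tame_densitySeries ε N Φ).atZero.mulDefined (tame_waveSeries ε A)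

/-- Setting t' = 0 is the ring homomorphism `killCompl`; being finitary, it passes through the
product in λ. -/
theorem DressingPair.eq_residue_atZero {ε : ℤˣ} {M N : PDO K} {C : ℕ+ → PDO K}
    (h : DressingPair ε M N C) {Φ : Fn K} (hΦ : ∀ n, dt n Φ = (C n).plusApply Φ) :
    Φ = residue (lmul (fun k => atZero (densitySeries ε N Φ k)) (waveSeries ε M)) := by
  have h1 := congrArg
    (MvPowerSeries.killCompl (R := K) (Function.Embedding.inl : ℕ+ ↪ ℕ+ ⊕ ℕ+)).toRingHom
    (h.spectralIntegral_eq hΦ)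
  rw [spectralIntegral, residue, (isFinitary_killCompl _).map_lmul
    (mulDefined_spectralIntegral ε N Φ M)] at h1
  have h2 : ∀ f : Fn K, (MvPowerSeries.killCompl (R := K)
      (Function.Embedding.inl : ℕ+ ↪ ℕ+ ⊕ ℕ+)).toRingHom (atT f) = f :=
    MvPowerSeries.killCompl_rename_app
  have h3 : ∀ f : Fn K, (MvPowerSeries.killCompl (R := K)
      (Function.Embedding.inl : ℕ+ ↪ ℕ+ ⊕ ℕ+)).toRingHom (atT' f) = atZero f :=
    killCompl_inl_atT'
  simp only [h2, h3] at h1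
  exact h1.symm

/-- The spectral representation of a solution `Φ` of the linear problem of a dressing pair. -/
theorem DressingPair.spectral_representation {ε : ℤˣ} {M N : PDO K} {C : ℕ+ → PDO K}
    (h : DressingPair ε M N C) {Φ : Fn K} (hΦ : ∀ n, dt n Φ = (C n).plusApply Φ) :
    MulDefined (waveSeries (-ε) N) (shift ((ε : ℤ) : ℚ) Φ) ∧
    MulDefined (fun k => atT' (densitySeries ε N Φ k)) (fun k => atT (waveSeries ε M k)) ∧
    atT Φ = residue
      (lmul (fun k => atT' (densitySeries ε N Φ k)) fun k => atT (waveSeries ε M k)) ∧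
    (∀ n : ℕ+, MvPowerSeries.pderiv K (Sum.inr n) (residue
      (lmul (fun k => atT' (densitySeries ε N Φ k)) fun k => atT (waveSeries ε M k))) = 0) ∧
    MulDefined (fun k => atZero (densitySeries ε N Φ k)) (waveSeries ε M) ∧
    Φ = residue (lmul (fun k => atZero (densitySeries ε N Φ k)) (waveSeries ε M)) := by
  have h1 := h.spectralIntegral_eq hΦ
  refine ⟨(tame_waveSeries _ _).mulDefined (tame_shift _ _),
    mulDefined_spectralIntegral ε N Φ M, h1.symm, fun n => ?_,
    mulDefined_atZero_density ε N Φ M, h.eq_residue_atZero hΦ⟩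
  change MvPowerSeries.pderiv K _ (spectralIntegral ε N Φ M) = 0
  rw [h1, pderiv_inr_atT]

end Representation

end

/-! ### The two dressing pairs attached to a dressing operator. -/

section Representation

variable {K : Type*} [CommRing K]

theorem PDO.lead_adj {W : PDO K} (h0 : W.coeff 0 = 1) (hW : W.OrdLE 0) : W.adj.coeff 0 = 1 := by
  have h := PDO.coeff_adj_of_ordLE hW 0
  simpa [h0] using h

variable {r : ℕ} {L Q W : PDO K}

theorem IsEigenfunction.dt_eq {Φ : Fn K} (h : IsEigenfunction Q Φ) (n : ℕ+) :
    dt n Φ = (Q ^ (n : ℕ)).plus.plusApply Φ := by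
  rw [PDO.plusApply_plus, h n]

theorem IsAdjEigenfunction.dt_eq {Ψ : Fn K} (h : IsAdjEigenfunction Q Ψ) (n : ℕ+) :
    dt n Ψ = (-(Q ^ (n : ℕ)).plus.adj).plusApply Ψ := by
  rw [PDO.adj_plus, PDO.adj_pow, h n, ← PDO.plusApply_plus]
  exact (map_neg (PDO.plusApplyHom Ψ) _).symm

namespace IsDressing

theorem adj_mul_inv (h : IsDressing r L Q W) : W.adj * W.adj.inv = 1 :=
  PDO.mul_inv (PDO.lead_adj h.lead h.above) (PDO.OrdLE.adj h.above)

theorem inv_mul_adj (h : IsDressing r L Q W) : W.adj.inv * W.adj = 1 :=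
  PDO.inv_mul (PDO.lead_adj h.lead h.above) (PDO.OrdLE.adj h.above)

theorem adj_inv_adj_mul (h : IsDressing r L Q W) : W.adj.inv.adj * W = 1 := by
  have := congrArg PDO.adj h.adj_mul_inv
  rwa [PDO.adj_mul, PDO.adj_adj, PDO.adj_one] at this

theorem mul_adj_inv_adj (h : IsDressing r L Q W) : W * W.adj.inv.adj = 1 := by
  have := congrArg PDO.adj h.inv_mul_adj
  rwa [PDO.adj_mul, PDO.adj_adj, PDO.adj_one] at this

/-- Take the adjoint of the Sato equation, then differentiate (W*)⁻¹ W* = 1 and multiply by (W*)⁻¹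
on the right. -/
theorem flow_adj_inv (h : IsDressing r L Q W) (n : ℕ+) :
    W.adj.inv.flow n = -(Q ^ (n : ℕ)).plus.adj * W.adj.inv -
      (-1 : ℤ) ^ ((n : ℕ) + 1) • (W.adj.inv * PDO.D (n : ℕ)) := by
  have h1 : W.adj.flow n = W.adj * (Q ^ (n : ℕ)).plus.adj -
      (-1 : ℤ) ^ (n : ℕ) • (PDO.D (n : ℕ) * W.adj) := by
    rw [PDO.flow_adj, h.sato, PDO.adj_sub, PDO.adj_mul, PDO.adj_mul, PDO.adj_D, smul_mul_assoc]
    simp [Int.negOnePow_def]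
  have h2 := congrArg (PDO.flow n) h.inv_mul_adj
  rw [PDO.flow_mul, show (1 : PDO K).flow n = 0 by rw [← PDO.D_zero, PDO.flow_D], h1] at h2
  have h3 := congrArg (· * W.adj.inv) h2
  simp only [add_mul, sub_mul, mul_sub, mul_assoc, smul_mul_assoc, mul_smul_comm, h.adj_mul_inv,
    mul_one, zero_mul] at h3
  rw [← mul_assoc W.adj.inv W.adj, h.inv_mul_adj, one_mul] at h3
  rw [eq_sub_iff_add_eq, pow_succ, mul_neg_one, neg_smul, neg_mul, ← sub_eq_add_neg,
    eq_neg_iff_add_eq_zero, ← h3]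
  abel

theorem dressingPair (h : IsDressing r L Q W) :
    DressingPair ((1 : ℤˣ) : ℤ) W W.adj.inv fun n => (Q ^ (n : ℕ)).plus where
  sign := by simp
  lead := h.lead
  ordLE := h.above
  lead' := PDO.coeff_zero_inv _
  ordLE' := PDO.inv_ordLE (PDO.lead_adj h.lead h.above) (PDO.OrdLE.adj h.above)
  mul_adj := h.mul_adj_inv_adj
  adj_mul := h.adj_inv_adj_mul
  isDiff n := PDO.isDiff_plus _
  flow_eq n := by
    rw [h.sato, Units.val_one, one_pow, one_smul]

theorem dressingPair_adj (h : IsDressing r L Q W) :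
    DressingPair ((-1 : ℤˣ) : ℤ) W.adj.inv W fun n => -(Q ^ (n : ℕ)).plus.adj where
  sign := by simp
  lead := PDO.coeff_zero_inv _
  ordLE := PDO.inv_ordLE (PDO.lead_adj h.lead h.above) (PDO.OrdLE.adj h.above)
  lead' := h.lead
  ordLE' := h.above
  mul_adj := h.inv_mul_adj
  adj_mul := h.adj_mul_inv
  isDiff n := (PDO.isDiff_plus _).adj.neg
  flow_eq n := by
    rw [h.flow_adj_inv, Units.val_neg, Units.val_one]

end IsDressing

variable [Algebra ℚ K]

theorem psi_eq_waveSeries (W : PDO K) : psi W = waveSeries 1 W := by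
  rw [psi, waveSeries]
  congr
  · funext k
    simp [symbolSeries]

theorem psiAdj_eq_waveSeries (W : PDO K) : psiAdj W = waveSeries (-1) W.adj.inv := by
  rw [psiAdj, waveSeries]
  congr

theorem density_eq_densitySeries (W : PDO K) (Φ : Fn K) :
    density W Φ = densitySeries 1 W.adj.inv Φ := by
  rw [density, densitySeries, psiAdj_eq_waveSeries]
  congr

theorem densityAdj_eq_densitySeries (W : PDO K) (Ψ : Fn K) :
    densityAdj W Ψ = densitySeries (-1) W Ψ := by
  rw [densityAdj, densitySeries, psi_eq_waveSeries, neg_neg]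
  congr

end Representation

end KP

end

theorem mainTheorem1 {K : Type*} [CommRing K] [Algebra ℚ K] (r : ℕ) (hr : 1 ≤ r)
    (L Q W : KP.PDO K) (hL : KP.IsKPLax r L Q) (hW : KP.IsDressing r L Q W) :
    (∀ Φ : KP.Fn K, KP.IsEigenfunction Q Φ →
      -- the products in the density and in the integrand are defined
      KP.MulDefined (KP.psiAdj W) (KP.shift 1 Φ) ∧
      KP.MulDefined (fun k => KP.atT' (KP.density W Φ k)) (fun k => KP.atT (KP.psi W k)) ∧
      -- `Φ (t) = ∫ dλ φ (λ) ψ (t, λ)`, where `φ (λ) = λ⁻¹ ψ* (t', λ) Φ (t' + [λ⁻¹])`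
      KP.atT Φ = KP.residue
        (KP.lmul (fun k => KP.atT' (KP.density W Φ k)) (fun k => KP.atT (KP.psi W k))) ∧
      -- the right-hand side does not depend on `t'`
      (∀ n : ℕ+, MvPowerSeries.pderiv K (Sum.inr n) (KP.residue
        (KP.lmul (fun k => KP.atT' (KP.density W Φ k)) (fun k => KP.atT (KP.psi W k)))) = 0) ∧
      -- the representation with the constant coefficients that `φ` has at `t' = 0`
      KP.MulDefined (fun k => KP.atZero (KP.density W Φ k)) (KP.psi W) ∧
      Φ = KP.residue (KP.lmul (fun k => KP.atZero (KP.density W Φ k)) (KP.psi W))) ∧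
    (∀ Ψ : KP.Fn K, KP.IsAdjEigenfunction Q Ψ →
      KP.MulDefined (KP.psi W) (KP.shift (-1) Ψ) ∧
      KP.MulDefined (fun k => KP.atT' (KP.densityAdj W Ψ k)) (fun k => KP.atT (KP.psiAdj W k)) ∧
      KP.atT Ψ = KP.residue
        (KP.lmul (fun k => KP.atT' (KP.densityAdj W Ψ k)) (fun k => KP.atT (KP.psiAdj W k))) ∧
      (∀ n : ℕ+, MvPowerSeries.pderiv K (Sum.inr n) (KP.residue
        (KP.lmul (fun k => KP.atT' (KP.densityAdj W Ψ k))
          (fun k => KP.atT (KP.psiAdj W k)))) = 0) ∧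
      KP.MulDefined (fun k => KP.atZero (KP.densityAdj W Ψ k)) (KP.psiAdj W) ∧
      Ψ = KP.residue (KP.lmul (fun k => KP.atZero (KP.densityAdj W Ψ k)) (KP.psiAdj W))) := by

  refine ⟨fun Φ hΦ => ?_, fun Ψ hΨ => ?_⟩
  · have h := hW.dressingPair.spectral_representation hΦ.dt_eq
    rw [← KP.density_eq_densitySeries, ← KP.psi_eq_waveSeries, ← KP.psiAdj_eq_waveSeries,
      Units.val_one, Int.cast_one] at h
    exact h
  · have h := hW.dressingPair_adj.spectral_representation hΨ.dt_eq
    rw [← KP.densityAdj_eq_densitySeries, ← KP.psiAdj_eq_waveSeries, neg_neg,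
      ← KP.psi_eq_waveSeries, Units.val_neg, Units.val_one, Int.cast_neg, Int.cast_one] at h
    exact h
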